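/- For each $n \ge 1$ let $M_n$ be a random $n\times n$ matrix whose entries are independent random variables taking the values $+1$ and $-1$ with probability $1/2$ each, and let $\mathrm{Per}(M_n) = \sum_{\sigma \in S_n} \prod_{i=1}^n (M_n)_{i\sigma(i)}$ be its permanent. Then, with probability $1-o(1)$ as $n\to\infty$, $|\mathrm{Per}(M_n)| = n^{(\frac12+o(1))n}$. That is, there is a deterministic sequence of real numbers $\delta_n \to 0$ such that the probability that $|\mathrm{Per}(M_n)| = n^{(\frac12+e)n}$ for some real $e$ with $|e|\le\delta_n$ tends to $1$ as $n\to\infty$. In particular, $\mathbb{P}(\mathrm{Per}(M_n)\neq 0)\to 1$ as $n\to\infty$. -/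

import Mathlib

open MeasureTheory ProbabilityTheory Filter Topology

/-- A random `n × n` real matrix `M`, defined on the probability space `(Ω, μ)`, is a
(symmetric) Bernoulli matrix if its entries are jointly independent random variables, each of
which takes the values `1` and `-1` with probability `1/2` each. -/
structure IsBernoulliMatrix {Ω : Type*} [MeasurableSpace Ω] (μ : Measure Ω) {n : ℕ}
    (M : Ω → Matrix (Fin n) (Fin n) ℝ) : Prop where
  measurable_entry : ∀ i j, Measurable fun ω => M ω i j
  indep : iIndepFun (fun (p : Fin n × Fin n) (ω : Ω) => M ω p.1 p.2) μ
  prob_one : ∀ i j, μ {ω | M ω i j = 1} = 1 / 2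
  prob_neg_one : ∀ i j, μ {ω | M ω i j = -1} = 1 / 2

/-! Expose the rows one at a time. After k rows the state s sends a set B of n - k unused columns to
the permanent of the exposed rows on the remaining columns. A new row acts by `rowStep`, a Laplace
expansion, so each new minor is a random signed sum of old ones, and after n rows s ∅ is the
permanent.

The upper bound is Chebyshev: the mean square of the permanent is n! ≤ n ^ n.

For the lower bound, follow the family of minors of size at least L (`heavy`), through the
alternative of `pairs_dichotomy`. Either most pairs (B, b), with B heavy and b in B, have B \ {b}
contained in many heavy sets; then by Littlewood–Offord almost all such B \ {b} are heavy after the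
next row, even with L raised by a factor close to √n. Or there is an unusual abundance of sets lying
in some but few heavy sets; each is heavy after the next row with probability at least 1/2, so the
family becomes much denser with probability at least 1/3. In the bad outcomes, a Chernoff argument
(`card_density_drop_le`) limits the loss of density to a constant factor, outside an exponentially
small event. A suitable potential is therefore almost a supermartingale, and
`failProb_le_of_potential` controls it.

Write n = a ^ N with N a large constant. Until about n / a ^ 3 columns remain, the potential charges
for sparsity and for rows without growth; at the end the threshold has grown in almost every row,
and the heavy family has density at least exp(-n / a ^ 6). Then L is frozen. The entropy inequality
`sum_log_updeg_le` shows that `defect` divided by the number m of unused columns hardly increases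
under passage to the shadow. It starts at O(a ^ (-3)), so with about a columns left the defect
itself is below 1, which is constant density. The last rows, about a in number, each lose too little
density to exhaust it. The loss in the exponent is of order 1 / N, and a diagonal argument lets it
tend to 0. -/

namespace BernoulliPermanent

open Finset
open scoped Classical

/-! ### Littlewood–Offord, Chernoff and Markov bounds, as counts of sign vectors. -/

section Anticoncentration

variable {α : Type*} [Fintype α] [DecidableEq α]

/-- The sign `±1` encoded by a Boolean. -/
noncomputable def sgn (b : Bool) : ℝ := if b then 1 else -1

lemma sgn_not (b : Bool) : sgn (!b) = -sgn b := by cases b <;> simp [sgn]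

lemma abs_sgn (b : Bool) : |sgn b| = 1 := by cases b <;> simp [sgn]

lemma sgn_mul_self (b : Bool) : sgn b * sgn b = 1 := by cases b <;> simp [sgn]

/-- The ratio of consecutive central binomials reduces the induction to (2k + 1)(2k + 3) ≤ 4(k +
1)². The factor 2k + 1, rather than 2k, lets Littlewood–Offord hold with constant 1 for index sets
of odd size too. -/
lemma centralBinom_sq_mul_le (k : ℕ) : k.centralBinom ^ 2 * (2 * k + 1) ≤ (4 ^ k) ^ 2 := by
  induction k with
  | zero => simp
  | succ k ih =>
    have h := Nat.succ_mul_centralBinom_succ k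
    have h2 : (k + 1) ^ 2 * ((k + 1).centralBinom ^ 2 * (2 * (k + 1) + 1)) ≤
        (k + 1) ^ 2 * (4 ^ (k + 1)) ^ 2 := by
      calc (k + 1) ^ 2 * ((k + 1).centralBinom ^ 2 * (2 * (k + 1) + 1))
          = ((k + 1) * (k + 1).centralBinom) ^ 2 * (2 * k + 3) := by ring
        _ = (2 * (2 * k + 1) * k.centralBinom) ^ 2 * (2 * k + 3) := by rw [h]
        _ = (4 * (2 * k + 1) * (2 * k + 3)) * (k.centralBinom ^ 2 * (2 * k + 1)) := by ring
        _ ≤ (16 * (k + 1) ^ 2) * (4 ^ k) ^ 2 := by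
            apply Nat.mul_le_mul _ ih
            nlinarith
        _ = (k + 1) ^ 2 * (4 ^ (k + 1)) ^ 2 := by ring
    exact Nat.le_of_mul_le_mul_left h2 (by positivity)

lemma card_forall_mem_eq_true (I : Finset α) :
    #{x : α → Bool | ∀ i ∈ I, x i = true} ≤ 2 ^ (Fintype.card α - #I) := by
  have : Fintype.card ({i // i ∉ I} → Bool) = 2 ^ (Fintype.card α - #I) := by
    rw [Fintype.card_fun, Fintype.card_bool, Fintype.card_subtype_compl, Fintype.card_coe]
  rw [← this, ← card_univ]
  refine card_le_card_of_injOn (fun x i => x i.1) (fun _ _ => mem_coe.2 (mem_univ _)) ?_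
  intro x hx y hy hxy
  funext i
  by_cases hi : i ∈ I
  · simp only [coe_filter, mem_univ, true_and, Set.mem_ofPred_eq] at hx hy
    rw [hx i hi, hy i hi]
  · exact congrFun hxy ⟨i, hi⟩

/-- Signed sums with the same signs off `I`, falling in a short window, form an antichain. -/
lemma card_window_fiber_le (c : α → ℝ) (J I : Finset α) (hIJ : I ⊆ J) {L : ℝ} (hL : 0 < L)
    (hI : ∀ i ∈ I, L ≤ |c i|) (t : ℝ) (z : α → Bool) :
    #{x : α → Bool | (t ≤ ∑ i ∈ J, sgn (x i) * c i ∧ ∑ i ∈ J, sgn (x i) * c i < t + 2 * L) ∧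
      ∀ i ∉ I, x i = z i} ≤ (#I).choose (#I / 2) := by
  set S : Finset (α → Bool) :=
    {x : α → Bool | (t ≤ ∑ i ∈ J, sgn (x i) * c i ∧ ∑ i ∈ J, sgn (x i) * c i < t + 2 * L) ∧
      ∀ i ∉ I, x i = z i} with hS
  -- Record where the signed term is positive. If f x is strictly contained in f y, the sum at y
  -- exceeds that at x by at least 2L, which the window forbids; so the image is an antichain and
  -- Sperner applies.
  let f : (α → Bool) → Finset I := fun x => {i | 0 < sgn (x i) * c i}
  have hc : ∀ i ∈ I, c i ≠ 0 := fun i hi h => by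
    have := hI i hi; rw [h, abs_zero] at this; linarith
  have key : ∀ i ∈ I, ∀ x : α → Bool,
      sgn (x i) * c i = if 0 < sgn (x i) * c i then |c i| else -|c i| := by
    intro i hi x
    have h1 : |sgn (x i) * c i| = |c i| := by rw [abs_mul, abs_sgn, one_mul]
    split_ifs with h
    · rw [← h1, abs_of_pos h]
    · rw [← h1, abs_of_nonpos (not_lt.1 h)]; ring
  have hinj : Set.InjOn f S := by
    intro x hx y hy hxy
    simp only [hS, coe_filter, mem_univ, true_and, Set.mem_ofPred_eq] at hx hy
    funext i
    by_cases hi : i ∈ I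
    · have h1 : (⟨i, hi⟩ : I) ∈ f x ↔ (⟨i, hi⟩ : I) ∈ f y := by rw [hxy]
      simp only [f, mem_filter, mem_univ, true_and] at h1
      have h2 : sgn (x i) * c i = sgn (y i) * c i := by
        rw [key i hi x, key i hi y]; simp only [h1]
      have h3 := mul_right_cancel₀ (hc i hi) h2
      cases hx' : x i <;> cases hy' : y i <;> simp [hx', hy', sgn] at h3 ⊢ <;> norm_num at h3
    · rw [hx.2 i hi, hy.2 i hi]
  have hanti : IsAntichain (· ⊆ ·) (SetLike.coe (S.image f)) := by
    intro A hA B hB hne hsub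
    simp only [coe_image, Set.mem_image, mem_coe] at hA hB
    obtain ⟨x, hx, rfl⟩ := hA
    obtain ⟨y, hy, rfl⟩ := hB
    simp only [hS, mem_filter, mem_univ, true_and] at hx hy
    obtain ⟨j, hjy, hjx⟩ : ∃ j, j ∈ f y ∧ j ∉ f x := by
      by_contra hcon
      push Not at hcon
      exact hne (Subset.antisymm hsub hcon)
    have hdiff : 2 * L ≤ ∑ i ∈ J, (sgn (y i) * c i - sgn (x i) * c i) := by
      have hterm : ∀ i ∈ J, 0 ≤ sgn (y i) * c i - sgn (x i) * c i := by
        intro i _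
        by_cases hi : i ∈ I
        · have hm : (⟨i, hi⟩ : I) ∈ f x → (⟨i, hi⟩ : I) ∈ f y := fun h => hsub h
          simp only [f, mem_filter, mem_univ, true_and] at hm
          rw [key i hi x, key i hi y]
          have := abs_nonneg (c i)
          by_cases h1 : 0 < sgn (x i) * c i
          · simp [h1, hm h1]
          · rw [if_neg h1]; split_ifs <;> linarith
        · rw [hx.2 i hi, hy.2 i hi, sub_self]
      refine le_trans ?_ (single_le_sum hterm (hIJ j.2))
      simp only [f, mem_filter, mem_univ, true_and] at hjx hjy
      rw [key j.1 j.2 x, key j.1 j.2 y, if_pos hjy, if_neg hjx]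
      have := hI j.1 j.2
      linarith
    rw [sum_sub_distrib] at hdiff
    linarith [hx.1.1, hy.1.2]
  calc #S = #(S.image f) := (card_image_of_injOn hinj).symm
    _ ≤ _ := by simpa using hanti.sperner

/-- **Erdős–Littlewood–Offord**, for a half-open window. -/
lemma littlewood_offord_window (c : α → ℝ) (J I : Finset α) (hIJ : I ⊆ J) {L : ℝ} (hL : 0 < L)
    (hI : ∀ i ∈ I, L ≤ |c i|) (t : ℝ) :
    (#{x : α → Bool | t ≤ ∑ i ∈ J, sgn (x i) * c i ∧ ∑ i ∈ J, sgn (x i) * c i < t + 2 * L} : ℝ)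
      * √(#I) ≤ 2 ^ Fintype.card α := by
  -- Drop at most one index to reach even size, where the Sperner bound is a central binomial
  -- coefficient.
  obtain ⟨I', hI'I, hcard⟩ := exists_subset_card_eq (s := I) (n := 2 * (#I / 2)) (by omega)
  set k := #I / 2 with hk
  set S : Finset (α → Bool) :=
    {x : α → Bool | t ≤ ∑ i ∈ J, sgn (x i) * c i ∧ ∑ i ∈ J, sgn (x i) * c i < t + 2 * L} with hS
  -- Erasing the signs on I' makes each fibre a family with fixed signs off I', as the antichain
  -- bound requires.
  let f : (α → Bool) → (α → Bool) := fun x i => if i ∈ I' then true else x i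
  have h1 : #S ≤ k.centralBinom * #(S.image f) := by
    apply card_le_mul_card_image
    intro z _
    refine le_trans (card_le_card ?_) (le_trans (card_window_fiber_le c J I' (hI'I.trans hIJ) hL
      (fun i hi => hI i (hI'I hi)) t z) ?_)
    · intro x hx
      simp only [hS, mem_filter, mem_univ, true_and] at hx ⊢
      refine ⟨hx.1, fun i hi => ?_⟩
      have := congrFun hx.2 i
      simpa [f, hi] using this
    · rw [hcard, Nat.mul_div_cancel_left _ (by norm_num), Nat.centralBinom_eq_two_mul_choose]
  have h2 : #(S.image f) ≤ 2 ^ (Fintype.card α - 2 * k) := by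
    rw [← hcard]
    refine le_trans (card_le_card ?_) (card_forall_mem_eq_true I')
    intro x hx
    obtain ⟨y, _, rfl⟩ := mem_image.1 hx
    simp only [mem_filter, mem_univ, true_and]
    intro i hi
    simp [f, hi]
  have h3 : 2 * k ≤ Fintype.card α := by rw [← hcard]; exact card_le_univ _
  have h4 : (k.centralBinom : ℝ) * √(#I) ≤ 4 ^ k := by
    apply le_of_sq_le_sq _ (by positivity)
    rw [mul_pow, Real.sq_sqrt (by positivity)]
    calc (k.centralBinom : ℝ) ^ 2 * #I ≤ (k.centralBinom : ℝ) ^ 2 * (2 * k + 1) := by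
          gcongr
          have : #I ≤ 2 * k + 1 := by omega
          exact_mod_cast this
      _ ≤ _ := by exact_mod_cast centralBinom_sq_mul_le k
  calc (#S : ℝ) * √(#I) ≤ (k.centralBinom * 2 ^ (Fintype.card α - 2 * k)) * √(#I) := by
        gcongr
        exact_mod_cast h1.trans (Nat.mul_le_mul_left _ h2)
    _ = (k.centralBinom * √(#I)) * 2 ^ (Fintype.card α - 2 * k) := by ring
    _ ≤ 4 ^ k * 2 ^ (Fintype.card α - 2 * k) := by gcongr
    _ = 2 ^ Fintype.card α := by
        rw [show (4 : ℝ) = 2 ^ 2 by norm_num, ← pow_mul, ← pow_add, Nat.add_sub_cancel' h3]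

/-- The interval (-gL, gL) is covered by ⌈g⌉ half-open windows of length 2L, and each obeys the
window bound. -/
lemma littlewood_offord (c : α → ℝ) (J I : Finset α) (hIJ : I ⊆ J) {L g : ℝ} (hL : 0 < L)
    (hg : 0 ≤ g) (hI : ∀ i ∈ I, L ≤ |c i|) :
    (#{x : α → Bool | |∑ i ∈ J, sgn (x i) * c i| < g * L} : ℝ) * √(#I) ≤
      (g + 1) * 2 ^ Fintype.card α := by
  set r := ⌈g⌉₊ with hr
  have hsub : ({x : α → Bool | |∑ i ∈ J, sgn (x i) * c i| < g * L} : Finset (α → Bool)) ⊆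
      (range r).biUnion fun l => {x : α → Bool | -(g * L) + 2 * L * l ≤ ∑ i ∈ J, sgn (x i) * c i ∧
        ∑ i ∈ J, sgn (x i) * c i < (-(g * L) + 2 * L * l) + 2 * L} := by
    intro x hx
    simp only [mem_filter, mem_univ, true_and, mem_biUnion, mem_range] at hx ⊢
    rw [abs_lt] at hx
    set s := ∑ i ∈ J, sgn (x i) * c i
    have h0 : 0 ≤ (s + g * L) / (2 * L) := by
      apply div_nonneg <;> linarith
    refine ⟨⌊(s + g * L) / (2 * L)⌋₊, ?_, ?_, ?_⟩
    · rw [Nat.floor_lt h0]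
      refine lt_of_lt_of_le ?_ (Nat.le_ceil g)
      rw [div_lt_iff₀ (by linarith)]
      nlinarith
    · have := Nat.floor_le h0
      rw [le_div_iff₀ (by linarith)] at this
      nlinarith
    · have := Nat.lt_floor_add_one ((s + g * L) / (2 * L))
      rw [div_lt_iff₀ (by linarith)] at this
      nlinarith
  have hcard := (card_le_card hsub).trans card_biUnion_le
  calc _ ≤ (∑ l ∈ range r, (#{x : α → Bool | -(g * L) + 2 * L * l ≤ ∑ i ∈ J, sgn (x i) * c i ∧
        ∑ i ∈ J, sgn (x i) * c i < (-(g * L) + 2 * L * l) + 2 * L} : ℝ)) * √(#I) := by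
        gcongr
        exact_mod_cast hcard
    _ ≤ ∑ l ∈ range r, (2 : ℝ) ^ Fintype.card α := by
        rw [sum_mul]
        exact sum_le_sum fun l _ => littlewood_offord_window c J I hIJ hL hI _
    _ = r * 2 ^ Fintype.card α := by simp
    _ ≤ _ := by
        gcongr
        exact (Nat.ceil_lt_add_one hg).le

/-- A Chernoff bound for the lower tail of a fair binomial variable. -/
lemma chernoff_quarter (Q : Finset α) :
    (#{y : α → Bool | 4 * #{b ∈ Q | y b = true} < #Q} : ℝ) ≤
      (9 / 10) ^ #Q * 2 ^ Fintype.card α := by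
  set S : Finset (α → Bool) := {y : α → Bool | 4 * #{b ∈ Q | y b = true} < #Q} with hS
  -- Exponential tilting with weight 81/256 = (3/4)^4 per true coordinate of Q: the mean factor is
  -- 337/512, the rare event forces the product above (3/4)^#Q, and 337/512 ≤ (9/10)(3/4).
  let w : α → Bool → ℝ := fun i b => if i ∈ Q ∧ b = true then 81 / 256 else 1
  have hw : ∀ i b, 0 ≤ w i b := fun i b => by simp only [w]; split_ifs <;> norm_num
  have hprod : ∀ y : α → Bool, ∏ i, w i (y i) = (81 / 256) ^ #{b ∈ Q | y b = true} := by
    intro y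
    simp only [w]
    rw [← prod_filter, prod_const]
    congr 2
    ext i
    simp
  have htot : ∑ y : α → Bool, ∏ i, w i (y i) = (337 / 512) ^ #Q * 2 ^ Fintype.card α := by
    have h := (prod_univ_sum (fun _ : α => (univ : Finset Bool)) w).symm
    rw [Fintype.piFinset_univ] at h
    rw [h]
    have h2 : ∀ i, ∑ b, w i b = (if i ∈ Q then 337 / 512 else 1) * 2 := by
      intro i
      by_cases hi : i ∈ Q <;> simp [w, hi] <;> norm_num
    simp_rw [h2]
    rw [prod_mul_distrib, prod_const, card_univ, ← prod_filter, prod_const]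
    simp
  have hlow : ∀ y ∈ S, (3 / 4 : ℝ) ^ #Q ≤ ∏ i, w i (y i) := by
    intro y hy
    simp only [hS, mem_filter, mem_univ, true_and] at hy
    rw [hprod, show (81 / 256 : ℝ) = (3 / 4) ^ 4 by norm_num, ← pow_mul]
    exact pow_le_pow_of_le_one (by norm_num) (by norm_num) hy.le
  have h1 : (#S : ℝ) * (3 / 4) ^ #Q ≤ (337 / 512) ^ #Q * 2 ^ Fintype.card α := by
    rw [← htot, ← nsmul_eq_mul]
    refine (card_nsmul_le_sum _ _ _ hlow).trans ?_
    exact sum_le_sum_of_subset_of_nonneg (subset_univ _) fun y _ _ => prod_nonneg fun i _ => hw _ _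
  have h2 : (337 / 512 : ℝ) ^ #Q ≤ (9 / 10) ^ #Q * (3 / 4) ^ #Q := by
    rw [← mul_pow]
    exact pow_le_pow_left₀ (by norm_num) (by norm_num) _
  have h3 : (0 : ℝ) < (3 / 4) ^ #Q := by positivity
  refine le_of_mul_le_mul_right (h1.trans ?_) h3
  nlinarith [pow_pos (show (0 : ℝ) < 2 by norm_num) (Fintype.card α)]

/-- **Markov's inequality** for counting failures of a family of events. -/
lemma card_many_failures_le {V β : Type*} [Fintype V] (G : Finset β) (E : V → β → Prop)
    [∀ x, DecidablePred (E x)] {η t : ℝ} (ht : 0 < t) (hη : 0 ≤ η)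
    (hE : ∀ C ∈ G, (#{x : V | E x C} : ℝ) ≤ η * Fintype.card V) :
    (#{x : V | t * #G < #{C ∈ G | E x C}} : ℝ) ≤ η / t * Fintype.card V := by
  set S : Finset V := {x : V | t * #G < #{C ∈ G | E x C}} with hS
  have hsum : ∑ x : V, (#{C ∈ G | E x C} : ℝ) ≤ η * Fintype.card V * #G := by
    simp_rw [card_filter, Nat.cast_sum]
    rw [sum_comm, mul_comm, ← nsmul_eq_mul]
    refine sum_le_card_nsmul _ _ _ fun C hC => ?_
    rw [← Nat.cast_sum, ← card_filter]
    exact hE C hC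
  rcases G.eq_empty_or_nonempty with rfl | hG
  · have : S = ∅ := by simp [hS]
    rw [this]
    simpa using (by positivity : 0 ≤ η / t * Fintype.card V)
  · have hpos : (0 : ℝ) < #G := by exact_mod_cast hG.card_pos
    have h1 : (#S : ℝ) * (t * #G) ≤ η * Fintype.card V * #G := by
      rw [← nsmul_eq_mul]
      refine (card_nsmul_le_sum S _ _ fun x hx => (mem_filter.1 hx).2.le).trans (le_trans ?_ hsum)
      exact sum_le_sum_of_subset_of_nonneg (subset_univ _) fun x _ _ => by positivity
    rw [div_mul_eq_mul_div, le_div_iff₀ ht]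
    nlinarith

end Anticoncentration

/-! ### Random rows acting on families of heavy minors. -/

section Expansion

variable {α : Type*} [Fintype α] [DecidableEq α]

/-- One step of the expansion of a permanent along a new row: from the permanents `s B` of the
exposed rows on the columns outside `B` to those with the row `x` added. -/
noncomputable def rowStep (x : α → Bool) (s : Finset α → ℝ) (C : Finset α) : ℝ :=
  ∑ i ∈ Cᶜ, sgn (x i) * s (insert i C)

/-- The `m`-sets of unused columns whose complementary minor is at least `L` in size. -/
noncomputable def heavy (s : Finset α → ℝ) (L : ℝ) (m : ℕ) : Finset (Finset α) :=
  {B ∈ powersetCard m univ | L ≤ |s B|}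

omit [DecidableEq α] in
lemma mem_heavy {s : Finset α → ℝ} {L : ℝ} {m : ℕ} {B : Finset α} :
    B ∈ heavy s L m ↔ #B = m ∧ L ≤ |s B| := by
  simp [heavy, mem_powersetCard]

/-- The number of members of `F` obtained from `C` by adding one element. -/
def updeg (F : Finset (Finset α)) (C : Finset α) : ℕ := #{i ∈ Cᶜ | insert i C ∈ F}

/-- A minor with many heavy children is likely to be very heavy. -/
lemma card_not_heavy_le (s : Finset α → ℝ) {L g K : ℝ} (hL : 0 < L) (hg : 0 ≤ g) (hK : 0 < K)
    (m : ℕ) (C : Finset α) (hC : K ≤ updeg (heavy s L m) C) :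
    (#{x : α → Bool | ¬ g * L ≤ |rowStep x s C|} : ℝ) ≤ (g + 1) / √K * 2 ^ Fintype.card α := by
  have h := littlewood_offord (fun i => s (insert i C)) Cᶜ {i ∈ Cᶜ | insert i C ∈ heavy s L m}
    (filter_subset _ _) hL hg (fun i hi => (mem_heavy.1 (mem_filter.1 hi).2).2)
  simp only [not_le]
  rw [div_mul_eq_mul_div, le_div_iff₀ (Real.sqrt_pos.2 hK)]
  refine le_trans ?_ h
  unfold rowStep
  gcongr
  exact hC

omit [Fintype α] in
lemma sgn_update_sum (x : α → Bool) (c : α → ℝ) (J : Finset α) {i : α} (hi : i ∈ J) :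
    ∑ j ∈ J, sgn (Function.update x i (!x i) j) * c j =
      ∑ j ∈ J, sgn (x j) * c j - 2 * (sgn (x i) * c i) := by
  rw [← add_sum_erase _ _ hi, ← add_sum_erase J (fun j => sgn (x j) * c j) hi]
  have : ∑ j ∈ J.erase i, sgn (Function.update x i (!x i) j) * c j =
      ∑ j ∈ J.erase i, sgn (x j) * c j :=
    sum_congr rfl fun j hj => by rw [Function.update_of_ne (ne_of_mem_erase hj)]
  rw [this, Function.update_self, sgn_not]
  ring

/-- A minor with a heavy child is heavy with probability at least one half. -/
lemma card_not_heavy_le_half (s : Finset α → ℝ) {L : ℝ}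
    (m : ℕ) (C : Finset α) (hC : 1 ≤ updeg (heavy s L m) C) :
    (#{x : α → Bool | ¬ L ≤ |rowStep x s C|} : ℝ) ≤ 1 / 2 * 2 ^ Fintype.card α := by
  obtain ⟨i, hi⟩ := card_pos.1 hC
  rw [mem_filter] at hi
  have ha := (mem_heavy.1 hi.2).2
  set S : Finset (α → Bool) := {x : α → Bool | ¬ L ≤ |rowStep x s C|} with hS
  -- Flipping the sign at i moves the sum by 2|s (insert i C)| ≥ 2L, so the two values cannot both
  -- lie in (-L, L): the flip injects failures into successes.
  have hle : #S ≤ #Sᶜ := by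
    refine card_le_card_of_injOn (fun x => Function.update x i (!x i)) ?_ ?_
    · intro x hx
      simp only [hS, coe_compl, Set.mem_compl_iff, mem_coe, mem_filter, mem_univ, true_and,
        not_le] at hx ⊢
      unfold rowStep at hx ⊢
      rw [sgn_update_sum x (fun j => s (insert j C)) Cᶜ hi.1]
      have h1 : |sgn (x i) * s (insert i C)| = |s (insert i C)| := by
        rw [abs_mul, abs_sgn, one_mul]
      set a := sgn (x i) * s (insert i C)
      set T := ∑ j ∈ Cᶜ, sgn (x j) * s (insert j C)
      have h2 : |2 * a| ≤ |T - 2 * a| + |T| := by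
        have := abs_sub T (T - 2 * a)
        rw [show T - (T - 2 * a) = 2 * a by ring] at this
        linarith
      rw [abs_mul, abs_two, h1] at h2
      linarith
    · intro x _ y _ hxy
      funext j
      have := congrFun hxy j
      by_cases hj : j = i
      · subst hj; simpa using this
      · simpa [hj] using this
  have htot : (#S : ℝ) + #Sᶜ = 2 ^ Fintype.card α := by
    have := card_add_card_compl S
    rw [Fintype.card_fun, Fintype.card_bool] at this
    exact_mod_cast this
  have : (#S : ℝ) ≤ #Sᶜ := by exact_mod_cast hle
  linarith

/-- Given a heavy `B`, it is exponentially likely that a quarter of its subsets of size one less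
are heavy after the next row. -/
lemma card_few_heavy_children_le (s : Finset α → ℝ) {L : ℝ} (B : Finset α) (hB : L ≤ |s B|) :
    (#{x : α → Bool | 4 * #{b ∈ B | L ≤ |rowStep x s (B.erase b)|} < #B} : ℝ) ≤
      (9 / 10) ^ #B * 2 ^ Fintype.card α := by
  refine le_trans ?_ (chernoff_quarter B)
  -- For b in B, the new minor at B \ {b} is ± s B plus R x b, and R depends only on the signs off
  -- B. It has size at least |s B| when the two terms do not oppose each other. The involution f
  -- replaces x b by the truth of this agreement, so the agreements behave as fair independent bits.
  let R : (α → Bool) → α → ℝ := fun x b => ∑ i ∈ Bᶜ, sgn (x i) * s (insert i (B.erase b))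
  let e : (α → Bool) → α → Bool := fun x b => decide (0 ≤ R x b * s B)
  let f : (α → Bool) → (α → Bool) := fun x b => if b ∈ B then (x b == e x b) else x b
  have hR : ∀ x b, R (f x) b = R x b := fun x b => sum_congr rfl fun i hi => by
    simp [f, mem_compl.1 hi]
  have hf : Function.Involutive f := by
    intro x
    funext b
    by_cases hb : b ∈ B
    · have : e (f x) b = e x b := by simp only [e, hR]
      simp only [f, hb, if_true] at this ⊢
      rw [this]
      cases x b <;> cases e x b <;> rfl
    · simp [f, hb]
  have hstep : ∀ x : α → Bool, ∀ b ∈ B, f x b = true → L ≤ |rowStep x s (B.erase b)| := by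
    intro x b hb hfb
    have hrow : rowStep x s (B.erase b) = sgn (x b) * s B + R x b := by
      unfold rowStep
      have : (B.erase b)ᶜ = insert b Bᶜ := by
        ext i; simp only [mem_compl, mem_erase, mem_insert]; tauto
      rw [this, sum_insert (by simpa using hb), insert_erase hb]
    simp only [f, hb, if_true, beq_iff_eq, e] at hfb
    rw [hrow]
    refine hB.trans ?_
    have hs : (s B) ^ 2 ≤ (sgn (x b) * s B + R x b) ^ 2 := by
      have h1 := sgn_mul_self (x b)
      have h2 : 0 ≤ sgn (x b) * (R x b * s B) := by
        by_cases h : 0 ≤ R x b * s B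
        · simp [hfb, h, sgn]
        · simp only [hfb, h, decide_false, sgn]
          simp only [Bool.false_eq_true, if_false]
          linarith
      have h3 : (sgn (x b) * s B + R x b) ^ 2 = (sgn (x b) * sgn (x b)) * s B ^ 2 +
        2 * (sgn (x b) * (R x b * s B)) + R x b ^ 2 := by ring
      rw [h3, h1]
      nlinarith [sq_nonneg (R x b)]
    exact sq_le_sq.1 hs
  norm_cast
  refine card_le_card_of_injOn f ?_ hf.injective.injOn
  intro x hx
  simp only [coe_filter, mem_univ, true_and, Set.mem_ofPred_eq] at hx ⊢
  refine lt_of_le_of_lt ?_ hx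
  gcongr with b hb
  exact hstep x b hb

lemma sum_card_insert_mem (F G : Finset (Finset α)) :
    ∑ C ∈ G, updeg F C = ∑ B ∈ F, #{b ∈ B | B.erase b ∈ G} := by
  unfold updeg
  rw [← card_sigma, ← card_sigma]
  refine card_bij' (fun p _ => ⟨insert p.2 p.1, p.2⟩) (fun p _ => ⟨p.1.erase p.2, p.2⟩) ?_ ?_ ?_ ?_
  · rintro ⟨C, i⟩ h
    simp only [mem_sigma, mem_filter, mem_compl] at h ⊢
    refine ⟨h.2.2, mem_insert_self _ _, ?_⟩
    rw [erase_insert h.2.1]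
    exact h.1
  · rintro ⟨B, b⟩ h
    simp only [mem_sigma, mem_filter, mem_compl] at h ⊢
    refine ⟨h.2.2, notMem_erase _ _, ?_⟩
    rw [insert_erase h.2.1]
    exact h.1
  · rintro ⟨C, i⟩ h
    simp only [mem_sigma, mem_filter, mem_compl] at h
    simp [erase_insert h.2.1]
  · rintro ⟨B, b⟩ h
    simp only [mem_sigma, mem_filter] at h
    simp [insert_erase h.2.1]

lemma updeg_le (F : Finset (Finset α)) (C : Finset α) : updeg F C ≤ Fintype.card α - #C := by
  rw [← card_compl]
  exact card_filter_le _ _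

/-- Heaviness survives the next row with exponentially small exceptional probability, at the cost
of a constant factor in density. -/
lemma card_density_drop_le (s : Finset α → ℝ) (L : ℝ) {m : ℕ} (hm : 1 ≤ m)
    (hmn : m ≤ Fintype.card α) :
    (#{x : α → Bool | 8 * ((Fintype.card α - m + 1 : ℝ) * #(heavy (rowStep x s) L (m - 1))) <
      m * #(heavy s L m)} : ℝ) ≤ 2 * (9 / 10) ^ m * 2 ^ Fintype.card α := by
  -- Outside this event half of the heavy sets have at least m / 4 heavy subsets of size m - 1. Such
  -- a subset is counted at most n - m + 1 times, whence the factor 8 = 2 · 4.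
  have h := card_many_failures_le (V := α → Bool) (heavy s L m)
    (fun x B => 4 * #{b ∈ B | L ≤ |rowStep x s (B.erase b)|} < #B)
    (η := (9 / 10) ^ m) (t := 1 / 2) (by norm_num) (by positivity) (fun B hB => by
      have := card_few_heavy_children_le s B (mem_heavy.1 hB).2
      rw [Fintype.card_fun, Fintype.card_bool]
      push_cast
      rw [(mem_heavy.1 hB).1] at this
      convert this using 6
      exact (mem_heavy.1 hB).1)
  rw [Fintype.card_fun, Fintype.card_bool] at h
  push_cast at h
  refine le_trans ?_ (h.trans_eq (by ring))
  refine Nat.cast_le.2 (card_le_card fun x hx => ?_)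
  simp only [mem_filter, mem_univ, true_and] at hx ⊢
  by_contra hcon
  rw [not_lt] at hcon
  refine absurd hx (not_lt.2 ?_)
  set F := heavy s L m with hF
  set G := heavy (rowStep x s) L (m - 1) with hG
  -- double count the pairs of heavy sets
  have h1 : (∑ C ∈ G, updeg F C : ℝ) ≤ (Fintype.card α - m + 1 : ℝ) * #G := by
    rw [mul_comm, ← nsmul_eq_mul]
    refine sum_le_card_nsmul _ _ _ fun C hC => ?_
    have h2 := updeg_le F C
    rw [(mem_heavy.1 hC).1] at h2
    have h3 : updeg F C + m ≤ Fintype.card α + 1 := by omega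
    have h4 : (updeg F C : ℝ) + m ≤ Fintype.card α + 1 := by exact_mod_cast h3
    linarith
  have h2 : ((#F : ℝ) / 2) * (m / 4) ≤ ∑ C ∈ G, (updeg F C : ℝ) := by
    have hgood : (#F : ℝ) / 2 ≤
        #{B ∈ F | ¬ 4 * #{b ∈ B | L ≤ |rowStep x s (B.erase b)|} < #B} := by
      have := card_filter_add_card_filter_not (s := F)
        (fun B => 4 * #{b ∈ B | L ≤ |rowStep x s (B.erase b)|} < #B)
      have h3 : (#{B ∈ F | 4 * #{b ∈ B | L ≤ |rowStep x s (B.erase b)|} < #B} : ℝ) +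
        #{B ∈ F | ¬ 4 * #{b ∈ B | L ≤ |rowStep x s (B.erase b)|} < #B} = #F := by
          exact_mod_cast this
      linarith
    have h5 := sum_card_insert_mem F G
    have h6 : (∑ C ∈ G, (updeg F C : ℝ)) = ∑ B ∈ F, (#{b ∈ B | B.erase b ∈ G} : ℝ) := by
      exact_mod_cast h5
    rw [h6]
    calc ((#F : ℝ) / 2) * (m / 4) ≤
        #{B ∈ F | ¬ 4 * #{b ∈ B | L ≤ |rowStep x s (B.erase b)|} < #B} * (m / 4 : ℝ) := by
          gcongr
      _ ≤ ∑ B ∈ F with ¬ 4 * #{b ∈ B | L ≤ |rowStep x s (B.erase b)|} < #B,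
            (#{b ∈ B | B.erase b ∈ G} : ℝ) := by
          rw [← nsmul_eq_mul]
          refine card_nsmul_le_sum _ _ _ fun B hB => ?_
          rw [mem_filter, not_lt] at hB
          have hBm := (mem_heavy.1 hB.1).1
          have h7 : #{b ∈ B | L ≤ |rowStep x s (B.erase b)|} = #{b ∈ B | B.erase b ∈ G} := by
            congr 1
            ext b
            simp only [mem_filter, hG, mem_heavy, and_congr_right_iff]
            intro hb
            simp [card_erase_of_mem hb, hBm]
          rw [h7, hBm] at hB
          have h8 : (m : ℝ) ≤ 4 * #{b ∈ B | B.erase b ∈ G} := by exact_mod_cast hB.2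
          linarith
      _ ≤ _ := sum_le_sum_of_subset_of_nonneg (filter_subset _ _) fun _ _ _ => by positivity
  linarith

/-- If every member of `G` has a heavy child, then a quarter of `G` is heavy after the next row
with probability at least one third. -/
lemma card_quarter_heavy_fails_le (s : Finset α → ℝ) {L : ℝ} {m : ℕ}
    (G : Finset (Finset α)) (hGm : ∀ C ∈ G, #C = m - 1)
    (hG : ∀ C ∈ G, 1 ≤ updeg (heavy s L m) C) :
    (#{x : α → Bool | 4 * (#(heavy (rowStep x s) L (m - 1)) : ℝ) < #G} : ℝ) ≤
      2 / 3 * 2 ^ Fintype.card α := by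
  -- Each member fails with probability at most 1/2, so by Markov more than 3/4 of them fail with
  -- probability at most (1/2)/(3/4) = 2/3.
  have h := card_many_failures_le (V := α → Bool) G (fun x C => ¬ L ≤ |rowStep x s C|)
    (η := 1 / 2) (t := 3 / 4) (by norm_num) (by positivity) (fun C hC => by
      rw [Fintype.card_fun, Fintype.card_bool]
      push_cast
      convert card_not_heavy_le_half s m C (hG C hC))
  rw [Fintype.card_fun, Fintype.card_bool] at h
  push_cast at h
  refine le_trans ?_ (h.trans_eq (by ring))
  refine Nat.cast_le.2 (card_le_card fun x hx => ?_)
  simp only [mem_filter, mem_univ, true_and] at hx ⊢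
  have h1 := card_filter_add_card_filter_not (s := G) (fun C => L ≤ |rowStep x s C|)
  have h2 : (#{C ∈ G | L ≤ |rowStep x s C|} : ℝ) + #{C ∈ G | ¬ L ≤ |rowStep x s C|} = #G := by
    exact_mod_cast h1
  have h3 : (#{C ∈ G | L ≤ |rowStep x s C|} : ℝ) ≤ #(heavy (rowStep x s) L (m - 1)) := by
    norm_cast
    refine card_le_card fun C hC => ?_
    rw [mem_filter] at hC
    exact mem_heavy.2 ⟨hGm C hC.1, hC.2⟩
  linarith

/-- If every member of `G` has many heavy children, then most of `G` is very heavy after the next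
row, with high probability. -/
lemma card_most_heavy_fails_le (s : Finset α → ℝ) {L g K t : ℝ} (hL : 0 < L) (hg : 0 ≤ g)
    (hK : 0 < K) (ht : 0 < t) {m : ℕ}
    (G : Finset (Finset α)) (hGm : ∀ C ∈ G, #C = m - 1)
    (hG : ∀ C ∈ G, K ≤ updeg (heavy s L m) C) :
    (#{x : α → Bool | (#(heavy (rowStep x s) (g * L) (m - 1)) : ℝ) < (1 - t) * #G} : ℝ) ≤
      (g + 1) / (t * √K) * 2 ^ Fintype.card α := by
  have h := card_many_failures_le (V := α → Bool) G (fun x C => ¬ g * L ≤ |rowStep x s C|)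
    (η := (g + 1) / √K) (t := t) ht (by positivity) (fun C hC => by
      rw [Fintype.card_fun, Fintype.card_bool]
      push_cast
      convert card_not_heavy_le s hL hg hK m C (hG C hC))
  rw [Fintype.card_fun, Fintype.card_bool] at h
  push_cast at h
  refine le_trans ?_ (h.trans_eq (by rw [div_div, mul_comm t]))
  refine Nat.cast_le.2 (card_le_card fun x hx => ?_)
  simp only [mem_filter, mem_univ, true_and] at hx ⊢
  have h1 := card_filter_add_card_filter_not (s := G) (fun C => g * L ≤ |rowStep x s C|)
  have h2 : (#{C ∈ G | g * L ≤ |rowStep x s C|} : ℝ) +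
      #{C ∈ G | ¬ g * L ≤ |rowStep x s C|} = #G := by
    exact_mod_cast h1
  have h3 : (#{C ∈ G | g * L ≤ |rowStep x s C|} : ℝ) ≤ #(heavy (rowStep x s) (g * L) (m - 1)) := by
    norm_cast
    refine card_le_card fun C hC => ?_
    rw [mem_filter] at hC
    exact mem_heavy.2 ⟨hGm C hC.1, hC.2⟩
  linarith

end Expansion

/-! ### An entropy inequality and a robust shadow bound. -/

section Entropy

variable {α : Type*} [Fintype α] [DecidableEq α]

lemma sum_link (F : Finset (Finset α)) (g : α → Finset α → ℝ) :
    ∑ B ∈ F, ∑ b ∈ B, g b (B.erase b) = ∑ b, ∑ B' ∈ F.memberSubfamily b, g b B' := by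
  rw [sum_sigma', sum_sigma']
  refine sum_bij' (fun p _ => ⟨p.2, p.1.erase p.2⟩) (fun p _ => ⟨insert p.1 p.2, p.1⟩)
    ?_ ?_ ?_ ?_ ?_
  · rintro ⟨B, b⟩ h
    simp only [mem_sigma, mem_univ, mem_memberSubfamily, true_and] at h ⊢
    rw [insert_erase h.2]
    exact ⟨h.1, notMem_erase _ _⟩
  · rintro ⟨b, B'⟩ h
    simp only [mem_sigma, mem_univ, mem_memberSubfamily, true_and] at h ⊢
    exact ⟨h.1, mem_insert_self _ _⟩
  · rintro ⟨B, b⟩ h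
    simp only [mem_sigma] at h
    simp [insert_erase h.2]
  · rintro ⟨b, B'⟩ h
    simp only [mem_sigma, mem_univ, mem_memberSubfamily, true_and] at h
    simp [erase_insert h.2]
  · rintro ⟨B, b⟩ _
    rfl

lemma sum_updeg_mul (F G : Finset (Finset α)) (h : Finset α → ℝ) :
    ∑ C ∈ G, updeg F C * h C = ∑ B ∈ F, ∑ b ∈ B with B.erase b ∈ G, h (B.erase b) := by
  simp_rw [sum_filter]
  rw [sum_link F (fun _ C => if C ∈ G then h C else 0)]
  have : ∀ C ∈ G, updeg F C * h C = ∑ b, if C ∈ F.memberSubfamily b then h C else 0 := by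
    intro C _
    rw [← sum_filter, sum_const, nsmul_eq_mul, updeg]
    congr 3
    ext i
    simp [and_comm]
  rw [sum_congr rfl this, sum_comm]
  refine sum_congr rfl fun b _ => ?_
  rw [← sum_filter, ← sum_filter, filter_mem_eq_inter, filter_mem_eq_inter, inter_comm]

/-- An element completing (B' ∪ {b}) \ {b'} to a member of F also completes B' \ {b'} to a member of
the link of b. This comparison drives the induction on links. -/
lemma updeg_le_updeg_memberSubfamily (F : Finset (Finset α)) {b b' : α} {B' : Finset α}
    (hb : b ∉ B') (hb' : b' ∈ B') :
    updeg F ((insert b B').erase b') ≤ updeg (F.memberSubfamily b) (B'.erase b') := by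
  have hne : b ≠ b' := fun h => hb (h ▸ hb')
  refine card_le_card fun i hi => ?_
  simp only [mem_filter, mem_compl, mem_erase, mem_insert, not_and, not_or,
    mem_memberSubfamily] at hi ⊢
  have hib : i ≠ b := fun h => (hi.1 (h ▸ hne)).1 h
  refine ⟨fun h => (hi.1 h).2, ?_, hib.symm, fun _ => hb⟩
  rw [insert_comm, ← erase_insert_of_ne hne]
  exact hi.2

/-- An entropy inequality: in a uniform family of `m`-sets, the average of the entropy of an element
of a random member conditional on the others is at most `1/m` of the total entropy. -/
lemma sum_log_updeg_le (m : ℕ) (F : Finset (Finset α)) (hF : ∀ B ∈ F, #B = m) :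
    ∑ B ∈ F, ∑ b ∈ B, Real.log (updeg F (B.erase b)) ≤ #F * Real.log (m.factorial * #F) := by
  induction m generalizing F with
  | zero =>
    have : ∑ B ∈ F, ∑ b ∈ B, Real.log (updeg F (B.erase b)) = 0 :=
      sum_eq_zero fun B hB => by rw [card_eq_zero.1 (hF B hB), sum_empty]
    rw [this]
    simpa using mul_nonneg (Nat.cast_nonneg _) (Real.log_natCast_nonneg (#F))
  | succ m ih =>
    rcases F.eq_empty_or_nonempty with rfl | hne
    · simp
    have hN : (0 : ℝ) < #F := by exact_mod_cast hne.card_pos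
    set E := ∑ B ∈ F, ∑ b ∈ B, Real.log (updeg F (B.erase b)) with hE
    let N : α → ℝ := fun b => #(F.memberSubfamily b)
    set P : ℝ := (m + 1) * #F with hP
    have hPpos : 0 < P := by positivity
    have hcardB : ∀ B ∈ F, (#B : ℝ) = m + 1 := fun B hB => by rw [hF B hB]; push_cast; rfl
    have hNP : ∑ b, N b = P := by
      have := sum_link F (fun _ _ => 1)
      simp only [sum_const, nsmul_eq_mul, mul_one] at this
      rw [← this, sum_congr rfl hcardB, sum_const, nsmul_eq_mul, hP, mul_comm]
    -- the bound from the links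
    have h1 : m * E ≤ P * Real.log m.factorial + ∑ b, N b * Real.log (N b) := by
      have hlink : m * E = ∑ b, ∑ B' ∈ F.memberSubfamily b, ∑ b' ∈ B',
          Real.log (updeg F ((insert b B').erase b')) := by
        rw [← sum_link F (fun b B' => ∑ b' ∈ B', Real.log (updeg F ((insert b B').erase b'))), hE,
          mul_sum]
        refine sum_congr rfl fun B hB => ?_
        have h2 : ∀ b ∈ B, ∑ b' ∈ B.erase b,
            Real.log (updeg F ((insert b (B.erase b)).erase b')) =
            ∑ b' ∈ B, Real.log (updeg F (B.erase b')) - Real.log (updeg F (B.erase b)) := by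
          intro b hb
          rw [insert_erase hb, ← add_sum_erase B _ hb]
          ring
        rw [sum_congr rfl h2, sum_sub_distrib, sum_const, nsmul_eq_mul, hcardB B hB]
        ring
      rw [hlink]
      calc _ ≤ ∑ b, N b * Real.log (m.factorial * N b) := by
            refine sum_le_sum fun b _ => ?_
            refine le_trans (sum_le_sum fun B' hB' => sum_le_sum fun b' hb' => ?_)
              (ih (F.memberSubfamily b) fun B' hB' => ?_)
            · rw [mem_memberSubfamily] at hB'
              refine Real.log_le_log ?_ ?_
              · have : 0 < updeg F ((insert b B').erase b') := by
                  refine card_pos.2 ⟨b', ?_⟩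
                  rw [mem_filter, insert_erase (mem_insert_of_mem hb')]
                  exact ⟨by simp, hB'.1⟩
                exact_mod_cast this
              · exact_mod_cast updeg_le_updeg_memberSubfamily F hB'.2 hb'
            · rw [mem_memberSubfamily] at hB'
              have := hF _ hB'.1
              rw [card_insert_of_notMem hB'.2] at this
              omega
        _ = _ := by
            rw [← hNP, sum_mul, ← sum_add_distrib]
            refine sum_congr rfl fun b _ => ?_
            by_cases hb : N b = 0
            · simp [hb]
            · rw [Real.log_mul (by positivity) hb]; ring
    -- conditioning decreases entropy
    have h2 : E + ∑ b, N b * Real.log (N b) ≤ P * Real.log P := by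
      -- For a uniform pair (B, b), N b / P is the law of b, and given B \ {b} the element b is
      -- uniform among `updeg` choices. Summing log x ≤ x - 1 at x = updeg · N b / P says that
      -- conditioning on B \ {b} does not increase the entropy of b.
      have hterm : ∀ b, ∀ B' ∈ F.memberSubfamily b,
          Real.log (updeg F B') + Real.log (N b) - Real.log P ≤ updeg F B' * (N b / P) - 1 := by
        intro b B' hB'
        have hu : (0 : ℝ) < updeg F B' := by
          rw [mem_memberSubfamily] at hB'
          have : 0 < updeg F B' := card_pos.2 ⟨b, by simp [hB'.1, hB'.2]⟩
          exact_mod_cast this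
        have hb : 0 < N b := by
          have : 0 < #(F.memberSubfamily b) := card_pos.2 ⟨B', hB'⟩
          simp only [N]; exact_mod_cast this
        have := Real.log_le_sub_one_of_pos (show 0 < updeg F B' * (N b / P) by positivity)
        rw [Real.log_mul hu.ne' (by positivity), Real.log_div hb.ne' hPpos.ne'] at this
        linarith
      have hsum := sum_le_sum fun b (_ : b ∈ univ) => sum_le_sum (hterm b)
      have hu : ∀ b, ∑ B' ∈ F.memberSubfamily b, (updeg F B' : ℝ) ≤ P := by
        intro b
        refine le_trans (sum_le_sum_of_subset_of_nonneg (subset_univ _)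
          fun _ _ _ => Nat.cast_nonneg _) ?_
        have := sum_updeg_mul F univ (fun _ => 1)
        simp only [mul_one, mem_univ, filter_true, sum_const, nsmul_eq_mul] at this
        rw [this, sum_congr rfl hcardB, sum_const, nsmul_eq_mul, hP, mul_comm]
      have hL : ∑ b, ∑ B' ∈ F.memberSubfamily b,
          (Real.log (updeg F B') + Real.log (N b) - Real.log P) =
          E + ∑ b, N b * Real.log (N b) - P * Real.log P := by
        rw [hE, sum_link F (fun _ C => Real.log (updeg F C)), ← hNP, sum_mul, ← sum_add_distrib,
          ← sum_sub_distrib]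
        refine sum_congr rfl fun b _ => ?_
        rw [sum_sub_distrib, sum_add_distrib, sum_const, sum_const, nsmul_eq_mul, nsmul_eq_mul]
      have hR : ∑ b, ∑ B' ∈ F.memberSubfamily b, (updeg F B' * (N b / P) - 1) ≤ 0 := by
        calc _ = ∑ b, ((∑ B' ∈ F.memberSubfamily b, (updeg F B' : ℝ)) * (N b / P) - N b) := by
              refine sum_congr rfl fun b _ => ?_
              rw [sum_sub_distrib, sum_const, nsmul_eq_mul, mul_one, sum_mul]
          _ ≤ ∑ b, (P * (N b / P) - N b) := by
              refine sum_le_sum fun b _ => ?_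
              gcongr
              exact hu b
          _ = 0 := sum_eq_zero fun b _ => by field_simp; ring
      linarith
    -- Adding the two bounds cancels the sums of N b log N b.
    have h3 : (m + 1) * E ≤ (m + 1) * (#F * Real.log ((m + 1).factorial * #F)) := by
      have : Real.log ((m + 1).factorial * #F) = Real.log m.factorial + Real.log P := by
        rw [← Real.log_mul (by positivity) hPpos.ne', Nat.factorial_succ]
        congr 1
        push_cast
        ring
      rw [this]
      calc _ ≤ P * Real.log m.factorial + P * Real.log P := by linarith
        _ = _ := by rw [hP]; ring
    exact le_of_mul_le_mul_left h3 (by positivity)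

/-- The deficiency, on a logarithmic scale, of `N` as a number of `m`-subsets of an `n`-set. -/
noncomputable def defect (n m : ℕ) (N : ℝ) : ℝ := m * Real.log n - Real.log (m.factorial * N)

omit [DecidableEq α] in
lemma card_mul_factorial_le (m : ℕ) (F : Finset (Finset α)) (hF : ∀ B ∈ F, #B = m) :
    (m.factorial * #F : ℝ) ≤ (Fintype.card α : ℝ) ^ m := by
  have h1 : #F ≤ (Fintype.card α).choose m := by
    rw [← card_univ, ← card_powersetCard]
    exact card_le_card fun B hB => mem_powersetCard.2 ⟨subset_univ _, hF B hB⟩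
  have h2 := Nat.descFactorial_eq_factorial_mul_choose (Fintype.card α) m
  have h3 := Nat.descFactorial_le_pow (Fintype.card α) m
  have : m.factorial * #F ≤ Fintype.card α ^ m :=
    (Nat.mul_le_mul_left _ h1).trans (h2 ▸ h3)
  exact_mod_cast this

omit [DecidableEq α] in
lemma defect_nonneg (m : ℕ) (F : Finset (Finset α)) (hF : ∀ B ∈ F, #B = m) (hne : F.Nonempty) :
    0 ≤ defect (Fintype.card α) m #F := by
  have hN : (0 : ℝ) < #F := by exact_mod_cast hne.card_pos
  rw [defect, sub_nonneg, ← Real.log_pow]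
  exact Real.log_le_log (by positivity) (card_mul_factorial_le m F hF)

/-- A robust form of the Kruskal–Katona theorem: if few of the pairs `(B, b)` have `B \ {b}`
contained in fewer than `U` members of `F`, the other sets `B \ {b}` are numerous. -/
lemma defect_robust_shadow_le {m : ℕ} (hm : 1 ≤ m) (F : Finset (Finset α))
    (hF : ∀ B ∈ F, #B = m) (hne : F.Nonempty) {U θ : ℝ} (hU : 0 < U) (hθ0 : 0 ≤ θ)
    (hθ : θ ≤ 1 / 2)
    (hgood : (1 - θ) * (m * #F) ≤ ∑ B ∈ F, (#{b ∈ B | U ≤ updeg F (B.erase b)} : ℝ)) :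
    0 < #{C : Finset α | U ≤ updeg F C} ∧
    defect (Fintype.card α) (m - 1) #{C : Finset α | U ≤ updeg F C} ≤
      (1 - 1 / m) * defect (Fintype.card α) m #F +
        2 * θ * (1 + Real.log (Fintype.card α)) := by
  set n := Fintype.card α with hn
  set G : Finset (Finset α) := {C : Finset α | U ≤ updeg F C} with hG
  have hN : (0 : ℝ) < #F := by exact_mod_cast hne.card_pos
  have hm0 : (0 : ℝ) < m := by exact_mod_cast hm
  have hmN : (0 : ℝ) < m * #F := by positivity
  set Pg : ℝ := ∑ B ∈ F, (#{b ∈ B | U ≤ updeg F (B.erase b)} : ℝ) with hPg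
  have hPg0 : 0 < Pg := lt_of_lt_of_le (by nlinarith) hgood
  set H : ℝ := #F * Real.log (m.factorial * #F) with hH
  have h1 : ∑ C ∈ G, (updeg F C : ℝ) = Pg := by
    have := sum_updeg_mul F G (fun _ => 1)
    simpa [hG, hPg] using this
  have hu1 : ∀ C, (0:ℝ) ≤ Real.log (updeg F C) := fun C => Real.log_natCast_nonneg _
  have h2 : ∑ C ∈ G, (updeg F C : ℝ) * Real.log (updeg F C) ≤ H := by
    rw [sum_updeg_mul F G]
    refine le_trans (sum_le_sum fun B _ => ?_) (sum_log_updeg_le m F hF)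
    exact sum_le_sum_of_subset_of_nonneg (filter_subset _ _) fun _ _ _ => hu1 _
  clear_value Pg
  obtain ⟨l, hl⟩ : ∃ l, l = H / Pg := ⟨_, rfl⟩
  -- Jensen with weights `updeg`, proved from the tangent line of exp: G carries total degree Pg,
  -- and its weighted mean log-degree is at most l, so it has at least Pg · exp(-l) members.
  have h3 : Pg * Real.exp (-l) ≤ #G := by
    have hterm : ∀ C ∈ G,
        Real.exp (-l) * (updeg F C * (1 + l) - updeg F C * Real.log (updeg F C)) ≤ 1 := by
      intro C hC
      rw [hG, mem_filter] at hC
      have hu : (0 : ℝ) < updeg F C := hU.trans_le hC.2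
      have h4 := Real.add_one_le_exp (-(Real.log (updeg F C) - l))
      have h5 : Real.exp (-(Real.log (updeg F C) - l)) = (updeg F C : ℝ)⁻¹ * Real.exp l := by
        rw [neg_sub, sub_eq_add_neg, Real.exp_add, Real.exp_neg, Real.exp_log hu, mul_comm]
      rw [h5] at h4
      have h6 : Real.exp (-l) * Real.exp l = 1 := by
        rw [← Real.exp_add, neg_add_cancel, Real.exp_zero]
      have h7 : 0 < Real.exp (-l) := Real.exp_pos _
      calc _ = (Real.exp (-l) * updeg F C) * (-(Real.log (updeg F C) - l) + 1) := by ring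
        _ ≤ (Real.exp (-l) * updeg F C) * ((updeg F C : ℝ)⁻¹ * Real.exp l) := by gcongr
        _ = (Real.exp (-l) * Real.exp l) * (updeg F C * (updeg F C : ℝ)⁻¹) := by ring
        _ = 1 := by rw [h6, mul_inv_cancel₀ hu.ne', one_mul]
    have hs := sum_le_sum hterm
    rw [← mul_sum, sum_sub_distrib, ← sum_mul, h1, sum_const, nsmul_eq_mul, mul_one] at hs
    refine le_trans ?_ hs
    rw [mul_comm]
    gcongr
    have : Pg * l = H := by rw [hl]; field_simp
    linarith
  have hG0 : (0 : ℝ) < #G := lt_of_lt_of_le (by positivity) h3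
  refine ⟨by exact_mod_cast hG0, ?_⟩
  have hlog : Real.log Pg - l ≤ Real.log #G := by
    have := Real.log_le_log (by positivity) h3
    rwa [Real.log_mul hPg0.ne' (Real.exp_pos _).ne', Real.log_exp] at this
  have h1θ : 0 < 1 - θ := by linarith
  have hlogPg : Real.log (m * #F) - 2 * θ ≤ Real.log Pg := by
    have h4 := Real.log_le_log (by positivity) hgood
    rw [Real.log_mul h1θ.ne' hmN.ne'] at h4
    have h5 := Real.one_sub_inv_le_log_of_pos h1θ
    have h6 : (1 - θ)⁻¹ ≤ 1 + 2 * θ := by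
      rw [inv_le_iff_one_le_mul₀ h1θ]; nlinarith
    linarith
  set A := Real.log (m.factorial * #F) with hA
  have hA0 : 0 ≤ A := by
    rw [hA]; exact_mod_cast Real.log_natCast_nonneg (m.factorial * #F)
  have hAle : A ≤ m * Real.log n := by
    have := defect_nonneg m F hF hne
    rw [defect] at this; linarith
  -- Replacing Pg by m · #F costs a factor 1 / (1 - θ) ≤ 1 + 2θ, and A / m ≤ log n turns the excess
  -- into 2θ log n.
  have hlle : l ≤ 1 / m * A + 2 * θ * Real.log n := by
    have h4 : l ≤ (1 + 2 * θ) * (1 / m * A) := by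
      rw [hl, div_le_iff₀ hPg0]
      calc H = #F * A := hH
        _ ≤ ((1 + 2 * θ) * (1 - θ)) * (#F * A) := by
            have h5 : 1 ≤ (1 + 2 * θ) * (1 - θ) := by nlinarith
            have h6 : 0 ≤ #F * A := by positivity
            nlinarith
        _ = (1 + 2 * θ) * (1 / m * A) * ((1 - θ) * (m * #F)) := by field_simp
        _ ≤ _ := by gcongr
    have h5 : 1 / m * A ≤ Real.log n := by
      rw [div_mul_eq_mul_div, one_mul, div_le_iff₀ hm0]; linarith
    nlinarith
  have hfac : Real.log ((m - 1).factorial) + Real.log (m * #F) = A := by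
    rw [← Real.log_mul (by positivity) hmN.ne', hA]
    congr 1
    rw [← mul_assoc]
    congr 1
    rw [← Nat.mul_factorial_pred (show m ≠ 0 by omega), mul_comm]
    push_cast
    rfl
  unfold defect
  rw [Real.log_mul (by positivity) hG0.ne', Nat.cast_sub hm, ← hA]
  push_cast
  have hid : (1 - 1 / (m : ℝ)) * (m * Real.log n - A) = (m - 1) * Real.log n - A + 1 / m * A := by
    field_simp
    ring
  rw [hid]
  linarith

end Entropy

/-! ### Failure probabilities of a random walk on states, and a maximal inequality. -/

section RandomSteps

variable {V S : Type*} [Fintype V]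

/-- The probability that the state reached after `r` uniformly random steps violates `P`. -/
noncomputable def failProb (step : V → S → S) (P : S → Prop) : ℕ → S → ℝ
  | 0, s => if P s then 0 else 1
  | r + 1, s => (∑ x, failProb step P r (step x s)) / Fintype.card V

variable (step : V → S → S)

lemma failProb_nonneg (P : S → Prop) (r : ℕ) (s : S) : 0 ≤ failProb step P r s := by
  induction r generalizing s with
  | zero => unfold failProb; split_ifs <;> norm_num
  | succ r ih => unfold failProb; exact div_nonneg (sum_nonneg fun x _ => ih _) (Nat.cast_nonneg _)

lemma failProb_le_one (P : S → Prop) (r : ℕ) (s : S) : failProb step P r s ≤ 1 := by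
  induction r generalizing s with
  | zero => unfold failProb; split_ifs <;> norm_num
  | succ r ih =>
    unfold failProb
    refine div_le_one_of_le₀ ?_ (Nat.cast_nonneg _)
    refine (sum_le_sum fun x _ => ih _).trans ?_
    simp

/-- Markov property and union bound at the intermediate time r: either Q fails there, or the
remaining r' steps fail with probability at most ε. -/
lemma failProb_add_le [Nonempty V] (P Q : S → Prop) (r r' : ℕ) {ε : ℝ} (hε : 0 ≤ ε)
    (h : ∀ s, Q s → failProb step P r' s ≤ ε) (s : S) :
    failProb step P (r + r') s ≤ failProb step Q r s + ε := by
  induction r generalizing s with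
  | zero =>
    rw [zero_add, failProb]
    split_ifs with hQ
    · linarith [h s hQ]
    · linarith [failProb_le_one step P r' s]
  | succ r ih =>
    rw [show r + 1 + r' = (r + r') + 1 by ring, failProb, failProb]
    have hV : (0 : ℝ) < Fintype.card V := by exact_mod_cast Fintype.card_pos
    rw [div_add' _ _ _ hV.ne']
    gcongr
    refine (sum_le_sum fun x _ => ih _).trans ?_
    rw [sum_add_distrib, sum_const, card_univ, nsmul_eq_mul, mul_comm ε]

/-- A **maximal inequality** for a nonnegative potential which is almost a supermartingale while it
stays below `T`. -/
lemma failProb_le_of_potential [Nonempty V] [DecidableEq V] (good : ℕ → S → Prop)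
    (Φ : ℕ → S → ℝ) {T : ℝ} (hT : 0 < T) (δ c : ℕ → ℝ) (hδ : ∀ k, 0 ≤ δ k) (hc : ∀ k, 0 ≤ c k)
    (hΦ : ∀ k s, good k s → 0 ≤ Φ k s) (k r : ℕ)
    (hstep : ∀ j, k ≤ j → j < k + r → ∀ s, good j s → Φ j s < T → ∃ O : Finset V,
      (#Oᶜ : ℝ) ≤ δ j * Fintype.card V ∧ (∀ x ∈ O, good (j + 1) (step x s)) ∧
      ∑ x ∈ O, Φ (j + 1) (step x s) ≤ Fintype.card V * (Φ j s + c j))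
    (s : S) (hs : good k s) :
    failProb step (fun s => good (k + r) s ∧ Φ (k + r) s < T) r s ≤
      ∑ j ∈ Ico k (k + r), δ j + (Φ k s + ∑ j ∈ Ico k (k + r), c j) / T := by
  -- From T upwards the asserted bound is at least 1. The induction can thus stop the walk when the
  -- potential reaches T, and the drift hypothesis is needed only below T.
  by_cases hΦT : Φ k s < T
  swap
  · have h1 : 1 ≤ (Φ k s + ∑ j ∈ Ico k (k + r), c j) / T := by
      rw [le_div_iff₀ hT]
      linarith [sum_nonneg fun j (_ : j ∈ Ico k (k + r)) => hc j]
    linarith [failProb_le_one step (fun s => good (k + r) s ∧ Φ (k + r) s < T) r s,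
      sum_nonneg fun j (_ : j ∈ Ico k (k + r)) => hδ j]
  induction r generalizing k s with
  | zero =>
    simp only [failProb, add_zero, hs, hΦT, and_self, if_true]
    simpa using div_nonneg (hΦ k s hs) hT.le
  | succ r ih =>
    have hV : (0 : ℝ) < Fintype.card V := by exact_mod_cast Fintype.card_pos
    obtain ⟨O, hO, hgood, hsum⟩ := hstep k le_rfl (by omega) s hs hΦT
    set Δ := ∑ j ∈ Ico (k + 1) (k + 1 + r), δ j with hΔ
    set Γ := ∑ j ∈ Ico (k + 1) (k + 1 + r), c j with hΓ
    have hΔ0 : 0 ≤ Δ := sum_nonneg fun j _ => hδ j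
    have hΓ0 : 0 ≤ Γ := sum_nonneg fun j _ => hc j
    have e1 : ∑ j ∈ Ico k (k + (r + 1)), δ j = δ k + Δ := by
      rw [hΔ, sum_eq_sum_Ico_succ_bot (by omega), show k + (r + 1) = k + 1 + r by ring]
    have e2 : ∑ j ∈ Ico k (k + (r + 1)), c j = c k + Γ := by
      rw [hΓ, sum_eq_sum_Ico_succ_bot (by omega), show k + (r + 1) = k + 1 + r by ring]
    rw [e1, e2, show k + (r + 1) = k + 1 + r by ring, failProb, div_le_iff₀ hV]
    rw [← sum_add_sum_compl O]
    have hin : ∀ x ∈ O, failProb step (fun s => good (k + 1 + r) s ∧ Φ (k + 1 + r) s < T) r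
        (step x s) ≤ Δ + (Φ (k + 1) (step x s) + Γ) / T := by
      intro x hx
      by_cases hx' : Φ (k + 1) (step x s) < T
      · exact ih (k + 1) (fun j h1 h2 => hstep j (by omega) (by omega)) _ (hgood x hx) hx'
      · have h1 : 1 ≤ (Φ (k + 1) (step x s) + Γ) / T := by
          rw [le_div_iff₀ hT]; linarith
        linarith [failProb_le_one step (fun s => good (k + 1 + r) s ∧ Φ (k + 1 + r) s < T) r
          (step x s)]
    have h1 := sum_le_sum hin
    have h2 : ∑ x ∈ Oᶜ, failProb step (fun s => good (k + 1 + r) s ∧ Φ (k + 1 + r) s < T) r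
        (step x s) ≤ δ k * Fintype.card V := by
      refine le_trans (sum_le_sum fun x _ => failProb_le_one step _ r _) ?_
      simpa using hO
    have h3 : ∑ x ∈ O, (Δ + (Φ (k + 1) (step x s) + Γ) / T) ≤
        Fintype.card V * (Δ + (Φ k s + c k + Γ) / T) := by
      rw [sum_add_distrib, ← sum_div, sum_add_distrib, sum_const, sum_const, nsmul_eq_mul,
        nsmul_eq_mul]
      have hOV : (#O : ℝ) ≤ Fintype.card V := by exact_mod_cast card_le_univ O
      calc _ ≤ Fintype.card V * Δ + (Fintype.card V * (Φ k s + c k) + Fintype.card V * Γ) / T := by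
            gcongr
        _ = _ := by ring
    calc _ ≤ Fintype.card V * (Δ + (Φ k s + c k + Γ) / T) + δ k * Fintype.card V :=
          add_le_add (h1.trans h3) h2
      _ = _ := by ring

/-- The state reached after the steps `xs`. -/
def runSteps (step : V → S → S) : (r : ℕ) → (Fin r → V) → S → S
  | 0, _, s => s
  | r + 1, xs, s => runSteps step r (Fin.tail xs) (step (xs 0) s)

lemma failProb_eq_card [Nonempty V] (P : S → Prop) (r : ℕ) (s : S) :
    failProb step P r s = #{xs : Fin r → V | ¬ P (runSteps step r xs s)} / Fintype.card V ^ r := by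
  induction r generalizing s with
  | zero =>
    rw [failProb]
    by_cases h : P s
    · simp [runSteps, h]
    · simp [runSteps, h]
  | succ r ih =>
    rw [failProb]
    simp_rw [ih]
    rw [← sum_div, div_div, ← pow_succ]
    congr 1
    simp_rw [card_filter]
    push_cast
    rw [← (Fin.consEquiv fun _ : Fin (r + 1) => V).sum_comp, Fintype.sum_prod_type]
    rfl

end RandomSteps

/-! ### The walk on states computes the permanent. -/

section Permanent

variable {n : ℕ}

/-- Iterated Laplace expansion: the r rows choose distinct columns outside C. The induction peels
off the first row, whose column must avoid C and the columns chosen by the later rows. -/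
lemma runSteps_rowStep (r : ℕ) (xs : Fin r → (Fin n → Bool)) (s : Finset (Fin n) → ℝ)
    (C : Finset (Fin n)) :
    runSteps rowStep r xs s C = ∑ f : Fin r → Fin n with
      (Function.Injective f ∧ ∀ i, f i ∉ C), (∏ i, sgn (xs i (f i))) * s (C ∪ univ.image f) := by
  induction r generalizing s with
  | zero => simp [runSteps, Function.injective_of_subsingleton, filter_true_of_mem]
  | succ r ih =>
    rw [runSteps, ih]
    simp only [rowStep]
    rw [sum_filter, sum_filter, ← (Fin.consEquiv fun _ : Fin (r + 1) => Fin n).sum_comp,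
      Fintype.sum_prod_type_right]
    refine sum_congr rfl fun f _ => ?_
    have hcond : ∀ i, (Function.Injective (Fin.cons i f : Fin (r + 1) → Fin n) ∧
        ∀ j, (Fin.cons i f : Fin (r + 1) → Fin n) j ∉ C) ↔
        (Function.Injective f ∧ ∀ i, f i ∉ C) ∧ i ∈ (C ∪ univ.image f)ᶜ := by
      intro i
      rw [Fin.cons_injective_iff, Fin.forall_fin_succ]
      simp only [Fin.cons_zero, Fin.cons_succ, mem_compl, mem_union, mem_image, mem_univ, true_and,
        Set.mem_range, not_or]
      tauto
    have himg : ∀ i, univ.image (Fin.cons i f : Fin (r + 1) → Fin n) = insert i (univ.image f) := by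
      intro i
      ext j
      simp [Fin.exists_fin_succ, eq_comm]
    have hterm : ∀ i, (Fin.consEquiv fun _ : Fin (r + 1) => Fin n) (i, f) = Fin.cons i f :=
      fun _ => rfl
    simp only [hterm, hcond, himg, Fin.prod_univ_succ, Fin.cons_zero, Fin.cons_succ, union_insert]
    by_cases hf : Function.Injective f ∧ ∀ i, f i ∉ C
    · simp only [hf, implies_true, and_self, true_and, if_true, ← sum_filter, filter_mem_eq_inter,
        univ_inter, mul_sum, not_false_eq_true]
      refine sum_congr rfl fun i _ => ?_
      simp only [Fin.tail]
      ring
    · rw [if_neg hf]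
      refine (sum_eq_zero fun i _ => ?_).symm
      rw [if_neg fun h => hf h.1]

/-- The initial state: no row exposed, the empty permanent being `1`. -/
noncomputable def initState (n : ℕ) (B : Finset (Fin n)) : ℝ := if B = univ then 1 else 0

lemma runSteps_initState (xs : Fin n → (Fin n → Bool)) :
    runSteps rowStep n xs (initState n) ∅ =
      (Matrix.of fun i j => sgn (xs i j)).permanent := by
  -- `Matrix.permanent` takes the entries at (σ i, i), whereas the expansion assigns a column to
  -- each row; hence the transpose.
  rw [runSteps_rowStep, ← Matrix.permanent_transpose, Matrix.permanent]
  simp only [notMem_empty, not_false_eq_true, implies_true, and_true, empty_union,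
    Matrix.transpose_apply, Matrix.of_apply]
  symm
  refine sum_bij (fun σ _ => ⇑σ) ?_ ?_ ?_ ?_
  · intro σ _
    simpa using σ.injective
  · intro σ _ τ _ h
    exact DFunLike.coe_injective h
  · intro f hf
    rw [mem_filter] at hf
    exact ⟨Equiv.ofBijective f (Finite.injective_iff_bijective.1 hf.2), mem_univ _, rfl⟩
  · intro σ _
    rw [initState, if_pos (image_univ_equiv σ), mul_one]

end Permanent

/-! ### One-step effect of a random row on sparsity, defect and density. -/

section Dichotomies

variable {α : Type*} [Fintype α] [DecidableEq α]

/-- Turns a typical bound `lo`, valid off an event W of probability at most p, and a worst-case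
bound `hi` into a drift estimate. Nonnegativity of `lo` allows the sum over O to be extended to all
rows. -/
lemma sum_le_of_two_bounds {V : Type*} [Fintype V] (O W : Finset V) (f : V → ℝ) {p lo hi : ℝ}
    (hlo : 0 ≤ lo) (hle : lo ≤ hi) (hW : (#W : ℝ) ≤ p * Fintype.card V)
    (h1 : ∀ x ∈ O, x ∉ W → f x ≤ lo) (h2 : ∀ x ∈ O, f x ≤ hi) :
    ∑ x ∈ O, f x ≤ Fintype.card V * (lo + p * (hi - lo)) := by
  calc ∑ x ∈ O, f x ≤ ∑ x ∈ O, (lo + if x ∈ W then hi - lo else 0) := by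
        refine sum_le_sum fun x hx => ?_
        split_ifs with h
        · linarith [h2 x hx]
        · linarith [h1 x hx h]
    _ ≤ ∑ x, (lo + if x ∈ W then hi - lo else 0) := by
        refine sum_le_sum_of_subset_of_nonneg (subset_univ _) fun x _ _ => ?_
        split_ifs <;> linarith
    _ = Fintype.card V * lo + #W * (hi - lo) := by
        rw [sum_add_distrib, sum_const, card_univ, nsmul_eq_mul, ← sum_filter, sum_const,
          nsmul_eq_mul, filter_mem_eq_inter, univ_inter]
    _ ≤ Fintype.card V * lo + (p * Fintype.card V) * (hi - lo) := by
        gcongr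
    _ = _ := by ring

lemma card_eq_of_updeg_pos {m : ℕ} {F : Finset (Finset α)} (hF : ∀ B ∈ F, #B = m) {C : Finset α}
    (hC : 0 < updeg F C) : #C = m - 1 := by
  obtain ⟨i, hi⟩ := card_pos.1 hC
  rw [mem_filter, mem_compl] at hi
  have := hF _ hi.2
  rw [card_insert_of_notMem hi.1] at this
  omega

lemma updeg_cast_le {m : ℕ} (hm : 1 ≤ m) (hmn : m ≤ Fintype.card α) {F : Finset (Finset α)}
    (hF : ∀ B ∈ F, #B = m) (C : Finset α) : (updeg F C : ℝ) ≤ Fintype.card α - m + 1 := by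
  have hmn' : (m : ℝ) ≤ Fintype.card α := by exact_mod_cast hmn
  rcases Nat.eq_zero_or_pos (updeg F C) with h0 | hpos
  · rw [h0]; push_cast; linarith
  · have h2 := updeg_le F C
    rw [card_eq_of_updeg_pos hF hpos] at h2
    have h3 : updeg F C + m ≤ Fintype.card α + 1 := by omega
    have h4 : (updeg F C : ℝ) + m ≤ Fintype.card α + 1 := by exact_mod_cast h3
    linarith

lemma sum_updeg_filter (F : Finset (Finset α)) (K : ℝ) :
    ∑ C : Finset α with K ≤ updeg F C, (updeg F C : ℝ) =
      ∑ B ∈ F, (#{b ∈ B | K ≤ updeg F (B.erase b)} : ℝ) := by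
  have := sum_updeg_mul F {C : Finset α | K ≤ updeg F C} (fun _ => 1)
  simpa using this

lemma sum_updeg {m : ℕ} {F : Finset (Finset α)} (hF : ∀ B ∈ F, #B = m) :
    ∑ C : Finset α, (updeg F C : ℝ) = m * #F := by
  have := sum_updeg_mul F univ (fun _ => 1)
  simp only [mul_one, mem_univ, filter_true, sum_const, nsmul_eq_mul] at this
  rw [this, sum_congr rfl fun B hB => by rw [hF B hB], sum_const, nsmul_eq_mul, mul_comm]

lemma sum_updeg_filter_le {m : ℕ} (hm : 1 ≤ m) (hmn : m ≤ Fintype.card α)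
    {F : Finset (Finset α)} (hF : ∀ B ∈ F, #B = m) (K : ℝ) :
    ∑ B ∈ F, (#{b ∈ B | K ≤ updeg F (B.erase b)} : ℝ) ≤
      (Fintype.card α - m + 1) * #{C : Finset α | K ≤ updeg F C} := by
  rw [← sum_updeg_filter, mul_comm, ← nsmul_eq_mul]
  exact sum_le_card_nsmul _ _ _ fun C _ => updeg_cast_le hm hmn hF C

/-- Count the pairs (B, b) by C = B \ {b}: sets C of degree zero contribute nothing, and those of
positive degree below K at most K each. -/
lemma mul_card_le {m : ℕ} {F : Finset (Finset α)} (hF : ∀ B ∈ F, #B = m) (K : ℝ) :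
    (m * #F : ℝ) ≤ ∑ B ∈ F, (#{b ∈ B | K ≤ updeg F (B.erase b)} : ℝ) +
      K * #{C : Finset α | 1 ≤ updeg F C ∧ (updeg F C : ℝ) < K} := by
  rw [← sum_updeg_filter, ← sum_updeg hF,
    ← sum_filter_add_sum_filter_not univ (fun C => K ≤ updeg F C) (fun C => (updeg F C : ℝ))]
  gcongr
  rw [mul_comm, ← nsmul_eq_mul]
  refine le_trans ?_ (sum_le_card_nsmul _ (fun C => (updeg F C : ℝ)) K fun C hC =>
    (mem_filter.1 hC).2.2.le)
  rw [← sum_subset (s₁ := {C : Finset α | 1 ≤ updeg F C ∧ (updeg F C : ℝ) < K})]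
  · intro C hC
    simp only [mem_filter, mem_univ, true_and, not_le] at hC ⊢
    exact hC.2
  · intro C hC hC'
    simp only [mem_filter, mem_univ, true_and, not_le, not_and] at hC hC'
    by_contra hne
    have : 1 ≤ updeg F C := Nat.one_le_iff_ne_zero.2 fun h => hne (by simp [h])
    linarith [hC' this]

/-- Either most pairs `(B, b)` are such that `B \ {b}` is contained in many members of `F`, or
there are many sets contained in some but few members of `F`. -/
lemma pairs_dichotomy {m : ℕ} {F : Finset (Finset α)} (hF : ∀ B ∈ F, #B = m) (K θ : ℝ) :
    (1 - θ) * (m * #F) ≤ ∑ B ∈ F, (#{b ∈ B | K ≤ updeg F (B.erase b)} : ℝ) ∨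
    θ * (m * #F) ≤ K * #{C : Finset α | 1 ≤ updeg F C ∧ (updeg F C : ℝ) < K} := by
  rw [or_iff_not_imp_left, not_le]
  intro h
  linarith [mul_card_le hF K]

/-- The logarithm of the reciprocal of the density of `N` sets among the `m`-subsets of an
`n`-set. -/
noncomputable def logSparsity (n m : ℕ) (N : ℝ) : ℝ := Real.log (n.choose m) - Real.log N

lemma choose_pred_mul {n m : ℕ} (hm : 1 ≤ m) (hmn : m ≤ n) :
    (n.choose (m - 1) : ℝ) * (n - m + 1) = n.choose m * m := by
  have := Nat.choose_succ_right_eq n (m - 1)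
  rw [Nat.sub_add_cancel hm] at this
  have h2 : ((n - (m - 1) : ℕ) : ℝ) = n - m + 1 := by
    rw [Nat.cast_sub (by omega), Nat.cast_sub hm]; push_cast; ring
  rw [← h2]
  exact_mod_cast this.symm

/-- By `choose_pred_mul` the hypothesis compares densities: N' sets among the (m - 1)-sets are at
least ρ times as dense as N sets among the m-sets. -/
lemma logSparsity_le {n m : ℕ} (hm : 1 ≤ m) (hmn : m ≤ n) {N N' ρ : ℝ} (hN : 0 < N) (hρ : 0 < ρ)
    (h : ρ * (m * N) ≤ (n - m + 1) * N') :
    0 < N' ∧ logSparsity n (m - 1) N' ≤ logSparsity n m N - Real.log ρ := by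
  have hmn' : (m : ℝ) ≤ n := by exact_mod_cast hmn
  have hm0 : (0 : ℝ) < m := by exact_mod_cast hm
  have hd : (0 : ℝ) < n - m + 1 := by linarith
  have hN' : 0 < N' := by
    by_contra hcon
    have : (n - m + 1 : ℝ) * N' ≤ 0 := mul_nonpos_of_nonneg_of_nonpos hd.le (not_lt.1 hcon)
    have : 0 < ρ * (m * N) := by positivity
    linarith
  refine ⟨hN', ?_⟩
  have hc : (0 : ℝ) < n.choose m := by exact_mod_cast Nat.choose_pos hmn
  have hc' : (0 : ℝ) < n.choose (m - 1) := by exact_mod_cast Nat.choose_pos (by omega)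
  have h1 := Real.log_le_log (by positivity) h
  rw [Real.log_mul hρ.ne' (by positivity), Real.log_mul hm0.ne' hN.ne',
    Real.log_mul hd.ne' hN'.ne'] at h1
  have h2 := congrArg Real.log (choose_pred_mul hm hmn)
  rw [Real.log_mul hc'.ne' hd.ne', Real.log_mul hc.ne' hm0.ne'] at h2
  unfold logSparsity
  linarith

omit [DecidableEq α] in
lemma logSparsity_nonneg (m : ℕ) (F : Finset (Finset α)) (hF : ∀ B ∈ F, #B = m)
    (hne : F.Nonempty) : 0 ≤ logSparsity (Fintype.card α) m #F := by
  have h1 : #F ≤ (Fintype.card α).choose m := by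
    rw [← card_univ, ← card_powersetCard]
    exact card_le_card fun B hB => mem_powersetCard.2 ⟨subset_univ _, hF B hB⟩
  have hN : (0 : ℝ) < #F := by exact_mod_cast hne.card_pos
  rw [logSparsity, sub_nonneg]
  exact Real.log_le_log hN (by exact_mod_cast h1)

/-- Passing from m to m - 1 absorbs the factor m into the factorial, and the leading term m log n
loses one log n; this is the gain when the shadow is as large as m N up to ρ. -/
lemma defect_le {n m : ℕ} (hm : 1 ≤ m) {N N' ρ : ℝ} (hN : 0 < N) (hρ : 0 < ρ)
    (h : ρ * (m * N) ≤ N') :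
    0 < N' ∧ defect n (m - 1) N' ≤ defect n m N - Real.log n - Real.log ρ := by
  have hm0 : (0 : ℝ) < m := by exact_mod_cast hm
  have hN' : 0 < N' := lt_of_lt_of_le (by positivity) h
  refine ⟨hN', ?_⟩
  have h1 := Real.log_le_log (by positivity) h
  rw [Real.log_mul hρ.ne' (by positivity), Real.log_mul hm0.ne' hN.ne'] at h1
  have h2 : Real.log m.factorial = Real.log m + Real.log (m - 1).factorial := by
    rw [← Real.log_mul hm0.ne' (by positivity), ← Nat.mul_factorial_pred (show m ≠ 0 by omega)]
    push_cast
    rfl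
  unfold defect
  rw [Real.log_mul (by positivity) hN'.ne', Real.log_mul (by positivity) hN.ne', h2,
    Nat.cast_sub hm]
  push_cast
  linarith

lemma neg_log_one_sub_le {t : ℝ} (ht0 : 0 ≤ t) (ht : t ≤ 1 / 2) : -Real.log (1 - t) ≤ 2 * t := by
  have h1 : 0 < 1 - t := by linarith
  have h5 := Real.one_sub_inv_le_log_of_pos h1
  have h6 : (1 - t)⁻¹ ≤ 1 + 2 * t := by
    rw [inv_le_iff_one_le_mul₀ h1]; nlinarith
  linarith

lemma log_eight_le : Real.log 8 ≤ 3 := by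
  rw [show (8 : ℝ) = 2 ^ 3 by norm_num, Real.log_pow]
  have := Real.log_two_lt_d9
  push_cast
  linarith

/-- The set of next rows for which the density of heavy minors does not collapse. -/
noncomputable def stableRows (s : Finset α → ℝ) (L : ℝ) (m : ℕ) : Finset (α → Bool) :=
  {x | (m : ℝ) * #(heavy s L m) ≤
    8 * ((Fintype.card α - m + 1 : ℝ) * #(heavy (rowStep x s) L (m - 1)))}

lemma card_stableRows_compl_le (s : Finset α → ℝ) (L : ℝ) {m : ℕ} (hm : 1 ≤ m)
    (hmn : m ≤ Fintype.card α) :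
    (#(stableRows s L m)ᶜ : ℝ) ≤ 2 * (9 / 10) ^ m * Fintype.card (α → Bool) := by
  rw [Fintype.card_fun, Fintype.card_bool]
  push_cast
  refine le_trans (le_of_eq ?_) (card_density_drop_le s L hm hmn)
  congr 2
  ext x
  simp [stableRows]

/-- The effect of one step on the density of heavy minors. -/
lemma exists_rows_logSparsity (s : Finset α → ℝ) {L g K θ : ℝ} {m : ℕ} (hL : 0 < L) (hg : 0 ≤ g)
    (hK : 0 < K) (hθ0 : 0 < θ) (hθ : θ ≤ 1 / 2) (hm : 1 ≤ m) (hmn : m ≤ Fintype.card α)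
    (hne : (heavy s L m).Nonempty) :
    (∃ W : Finset (α → Bool), (#W : ℝ) ≤ (g + 1) / (θ * √K) * Fintype.card (α → Bool) ∧
      ∀ x ∉ W, (heavy (rowStep x s) (g * L) (m - 1)).Nonempty ∧
        logSparsity (Fintype.card α) (m - 1) #(heavy (rowStep x s) (g * L) (m - 1)) ≤
          logSparsity (Fintype.card α) m #(heavy s L m) + 4 * θ) ∨
    (Real.log (θ * (Fintype.card α - m + 1) / K) ≤
        logSparsity (Fintype.card α) m #(heavy s L m) ∧
      ∃ W : Finset (α → Bool), (#W : ℝ) ≤ 2 / 3 * Fintype.card (α → Bool) ∧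
      ∀ x ∉ W, (heavy (rowStep x s) L (m - 1)).Nonempty ∧
        logSparsity (Fintype.card α) (m - 1) #(heavy (rowStep x s) L (m - 1)) ≤
          logSparsity (Fintype.card α) m #(heavy s L m) -
            Real.log (θ * (Fintype.card α - m + 1) / (4 * K))) := by
  set n := Fintype.card α with hn
  set F := heavy s L m with hFdef
  have hF : ∀ B ∈ F, #B = m := fun B hB => (mem_heavy.1 hB).1
  have hN : (0 : ℝ) < #F := by exact_mod_cast hne.card_pos
  have hmn' : (m : ℝ) ≤ n := by exact_mod_cast hmn
  have hm0 : (0 : ℝ) < m := by exact_mod_cast hm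
  have hd : (0 : ℝ) < n - m + 1 := by linarith
  have hcardV : (Fintype.card (α → Bool) : ℝ) = 2 ^ n := by
    rw [Fintype.card_fun, Fintype.card_bool]; push_cast; rfl
  rw [hcardV]
  rcases pairs_dichotomy hF K θ with h | h
  · left
    set G : Finset (Finset α) := {C : Finset α | K ≤ updeg F C} with hG
    have hGd : ∀ C ∈ G, K ≤ updeg F C := fun C hC => (mem_filter.1 hC).2
    have hGm : ∀ C ∈ G, #C = m - 1 := fun C hC => card_eq_of_updeg_pos hF (by
      have := hK.trans_le (hGd C hC)
      exact_mod_cast this)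
    refine ⟨_, card_most_heavy_fails_le s hL hg hK hθ0 G hGm hGd, fun x hx => ?_⟩
    rw [mem_filter, not_and, not_lt] at hx
    have hx' := hx (mem_univ _)
    have h1 := h.trans (sum_updeg_filter_le hm hmn hF K)
    have h1θ : 0 < 1 - θ := by linarith
    -- One factor 1 - θ is for pairs outside the dichotomy's good set, the other for members of G
    -- that fail; each costs at most 2θ in logarithm.
    have h2 : ((1 - θ) * (1 - θ)) * (m * #F) ≤
        (n - m + 1) * #(heavy (rowStep x s) (g * L) (m - 1)) := by
      calc ((1 - θ) * (1 - θ)) * (m * #F) = (1 - θ) * ((1 - θ) * (m * #F)) := by ring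
        _ ≤ (1 - θ) * ((n - m + 1) * #G) := by gcongr
        _ = (n - m + 1) * ((1 - θ) * #G) := by ring
        _ ≤ _ := by gcongr
    obtain ⟨h3, h4⟩ := logSparsity_le hm hmn hN (by positivity) h2
    refine ⟨card_pos.1 (by exact_mod_cast h3), h4.trans ?_⟩
    rw [Real.log_mul h1θ.ne' h1θ.ne']
    linarith [neg_log_one_sub_le hθ0.le hθ]
  · right
    set G : Finset (Finset α) := {C : Finset α | 1 ≤ updeg F C ∧ (updeg F C : ℝ) < K} with hG
    have hGd : ∀ C ∈ G, 1 ≤ updeg F C := fun C hC => (mem_filter.1 hC).2.1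
    have hGm : ∀ C ∈ G, #C = m - 1 := fun C hC => card_eq_of_updeg_pos hF (hGd C hC)
    have hGcard : (0 : ℝ) < #G := by
      by_contra hcon
      have : K * #G ≤ 0 := mul_nonpos_of_nonneg_of_nonpos hK.le (not_lt.1 hcon)
      have : 0 < θ * (m * #F) := by positivity
      linarith
    constructor
    · have h1 : (θ * (n - m + 1) / K) * (m * #F) ≤ (n - m + 1) * #G := by
        rw [div_mul_eq_mul_div, div_le_iff₀ hK]
        nlinarith
      obtain ⟨_, h3⟩ := logSparsity_le hm hmn hN (by positivity) h1
      have := logSparsity_nonneg (m - 1) G hGm (card_pos.1 (by exact_mod_cast hGcard))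
      linarith
    · refine ⟨_, card_quarter_heavy_fails_le s G hGm hGd, fun x hx => ?_⟩
      rw [mem_filter, not_and, not_lt] at hx
      have hx' := hx (mem_univ _)
      have h1 : (θ * (n - m + 1) / (4 * K)) * (m * #F) ≤
          (n - m + 1) * #(heavy (rowStep x s) L (m - 1)) := by
        rw [div_mul_eq_mul_div, div_le_iff₀ (by positivity)]
        calc _ = (n - m + 1) * (θ * (m * #F)) := by ring
          _ ≤ (n - m + 1) * (K * #G) := by gcongr
          _ ≤ (n - m + 1) * (K * (4 * #(heavy (rowStep x s) L (m - 1)))) := by gcongr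
          _ = _ := by ring
      obtain ⟨h3, h4⟩ := logSparsity_le hm hmn hN (by positivity) h1
      exact ⟨card_pos.1 (by exact_mod_cast h3), h4⟩

lemma logSparsity_of_mem_stableRows {s : Finset α → ℝ} {L : ℝ} {m : ℕ} (hm : 1 ≤ m)
    (hmn : m ≤ Fintype.card α) (hne : (heavy s L m).Nonempty) {x : α → Bool}
    (hx : x ∈ stableRows s L m) :
    (heavy (rowStep x s) L (m - 1)).Nonempty ∧
      logSparsity (Fintype.card α) (m - 1) #(heavy (rowStep x s) L (m - 1)) ≤
        logSparsity (Fintype.card α) m #(heavy s L m) + 3 := by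
  rw [stableRows, mem_filter] at hx
  obtain ⟨h3, h4⟩ := logSparsity_le (ρ := 1 / 8)
    (N' := #(heavy (rowStep x s) L (m - 1))) hm hmn
    (show (0 : ℝ) < #(heavy s L m) by exact_mod_cast hne.card_pos)
    (by norm_num) (by linarith [hx.2])
  refine ⟨card_pos.1 (by exact_mod_cast h3), h4.trans ?_⟩
  rw [one_div, Real.log_inv]
  linarith [log_eight_le]

lemma defect_of_mem_stableRows {s : Finset α → ℝ} {L : ℝ} {m : ℕ} (hm : 1 ≤ m)
    (hmn : m ≤ Fintype.card α) (hne : (heavy s L m).Nonempty) {x : α → Bool}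
    (hx : x ∈ stableRows s L m) :
    (heavy (rowStep x s) L (m - 1)).Nonempty ∧
      defect (Fintype.card α) (m - 1) #(heavy (rowStep x s) L (m - 1)) ≤
        defect (Fintype.card α) m #(heavy s L m) + 3 := by
  rw [stableRows, mem_filter] at hx
  have hn : (1 : ℝ) ≤ Fintype.card α := by exact_mod_cast hm.trans hmn
  have hm1 : (1 : ℝ) ≤ m := by exact_mod_cast hm
  -- Bounding n - m + 1 by n makes ρ = 1 / (8n), whose logarithm cancels the gain log n and leaves
  -- log 8 ≤ 3.
  obtain ⟨h3, h4⟩ := defect_le (n := Fintype.card α) (ρ := 1 / (8 * Fintype.card α)) hm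
    (show (0 : ℝ) < #(heavy s L m) by exact_mod_cast hne.card_pos)
    (by positivity) (N' := #(heavy (rowStep x s) L (m - 1))) (by
      rw [div_mul_eq_mul_div, one_mul, div_le_iff₀ (by positivity)]
      have : (0 : ℝ) ≤ #(heavy (rowStep x s) L (m - 1)) := Nat.cast_nonneg _
      nlinarith [hx.2])
  refine ⟨card_pos.1 (by exact_mod_cast h3), h4.trans ?_⟩
  rw [one_div, Real.log_inv, Real.log_mul (by norm_num) (by positivity)]
  linarith [log_eight_le]

/-- The effect of one step on the defect of the family of heavy minors. -/
lemma exists_rows_defect (s : Finset α → ℝ) {L U θ t : ℝ} {m : ℕ} (hL : 0 < L)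
    (hU : 0 < U) (hθ0 : 0 < θ) (hθ : θ ≤ 1 / 2) (ht0 : 0 < t) (ht : t ≤ 1 / 2) (hm : 1 ≤ m)
    (hne : (heavy s L m).Nonempty) :
    (∃ W : Finset (α → Bool), (#W : ℝ) ≤ 2 / (t * √U) * Fintype.card (α → Bool) ∧
      ∀ x ∉ W, defect (Fintype.card α) (m - 1) #(heavy (rowStep x s) L (m - 1)) ≤
        (1 - 1 / m) * defect (Fintype.card α) m #(heavy s L m) +
          2 * θ * (1 + Real.log (Fintype.card α)) + 2 * t) ∨
    (Real.log (Fintype.card α) - Real.log (4 * U / θ) ≤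
        defect (Fintype.card α) m #(heavy s L m) ∧
      ∃ W : Finset (α → Bool), (#W : ℝ) ≤ 2 / 3 * Fintype.card (α → Bool) ∧
      ∀ x ∉ W, defect (Fintype.card α) (m - 1) #(heavy (rowStep x s) L (m - 1)) ≤
          defect (Fintype.card α) m #(heavy s L m) -
            (Real.log (Fintype.card α) - Real.log (4 * U / θ))) := by
  set n := Fintype.card α with hn
  set F := heavy s L m with hFdef
  have hF : ∀ B ∈ F, #B = m := fun B hB => (mem_heavy.1 hB).1
  have hN : (0 : ℝ) < #F := by exact_mod_cast hne.card_pos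
  have hm0 : (0 : ℝ) < m := by exact_mod_cast hm
  have hcardV : (Fintype.card (α → Bool) : ℝ) = 2 ^ n := by
    rw [Fintype.card_fun, Fintype.card_bool]; push_cast; rfl
  rw [hcardV]
  rcases pairs_dichotomy hF U θ with h | h
  · left
    obtain ⟨hpos, hdef⟩ := defect_robust_shadow_le hm F hF hne hU hθ0.le hθ h
    set G : Finset (Finset α) := {C : Finset α | U ≤ updeg F C} with hG
    have hGd : ∀ C ∈ G, U ≤ updeg F C := fun C hC => (mem_filter.1 hC).2
    have hGm : ∀ C ∈ G, #C = m - 1 := fun C hC => card_eq_of_updeg_pos hF (by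
      have := hU.trans_le (hGd C hC)
      exact_mod_cast this)
    refine ⟨_, le_of_le_of_eq (card_most_heavy_fails_le s hL zero_le_one hU ht0 G hGm hGd) (by
      rw [one_add_one_eq_two]), fun x hx => ?_⟩
    rw [mem_filter, not_and, not_lt, one_mul] at hx
    have hx' := hx (mem_univ _)
    have hG0 : (0 : ℝ) < #G := by exact_mod_cast hpos
    have h1t : 0 < 1 - t := by linarith
    have h1 := Real.log_le_log (by positivity) hx'
    rw [Real.log_mul h1t.ne' hG0.ne'] at h1
    have h2 : defect n (m - 1) #(heavy (rowStep x s) L (m - 1)) ≤ defect n (m - 1) #G + 2 * t := by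
      have h3 : (0 : ℝ) < #(heavy (rowStep x s) L (m - 1)) := lt_of_lt_of_le (by positivity) hx'
      unfold defect
      rw [Real.log_mul (by positivity) h3.ne', Real.log_mul (by positivity) hG0.ne']
      linarith [neg_log_one_sub_le ht0.le ht]
    linarith
  · right
    set G : Finset (Finset α) := {C : Finset α | 1 ≤ updeg F C ∧ (updeg F C : ℝ) < U} with hG
    have hGd : ∀ C ∈ G, 1 ≤ updeg F C := fun C hC => (mem_filter.1 hC).2.1
    have hGm : ∀ C ∈ G, #C = m - 1 := fun C hC => card_eq_of_updeg_pos hF (hGd C hC)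
    have hlog : Real.log (4 * U / θ) = -Real.log (θ / (4 * U)) := by
      rw [← Real.log_inv, inv_div]
    have hG4 : θ / (4 * U) * (m * #F) ≤ #G / 4 := by
      rw [div_mul_eq_mul_div, div_le_iff₀ (by positivity)]
      linarith
    constructor
    · have h1 : θ / (4 * U) * (m * #F) ≤ #G := by
        have : (0 : ℝ) ≤ #G := Nat.cast_nonneg _
        linarith
      obtain ⟨h2, h3⟩ := defect_le (n := n) hm hN (by positivity) h1
      have := defect_nonneg (m - 1) G hGm (card_pos.1 (by exact_mod_cast h2))
      linarith
    · refine ⟨_, card_quarter_heavy_fails_le s G hGm hGd, fun x hx => ?_⟩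
      rw [mem_filter, not_and, not_lt] at hx
      have hx' := hx (mem_univ _)
      obtain ⟨_, h3⟩ := defect_le (n := n) hm hN (show 0 < θ / (4 * U) by positivity)
        (N' := #(heavy (rowStep x s) L (m - 1))) (by linarith)
      linarith

/-- Once the heavy minors have positive density, this density is almost preserved. -/
lemma exists_rows_density (s : Finset α → ℝ) {L U t : ℝ} {m : ℕ} (hL : 0 < L)
    (hU : 0 < U) (ht0 : 0 < t) (hm : 1 ≤ m)
    (hmn : m ≤ Fintype.card α) :
    ∃ W : Finset (α → Bool), (#W : ℝ) ≤ 2 / (t * √U) * Fintype.card (α → Bool) ∧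
      ∀ x ∉ W, (#(heavy s L m) : ℝ) / (Fintype.card α).choose m - U / (Fintype.card α - m + 1) - t ≤
        #(heavy (rowStep x s) L (m - 1)) / (Fintype.card α).choose (m - 1) := by
  set n := Fintype.card α with hn
  set F := heavy s L m with hFdef
  have hF : ∀ B ∈ F, #B = m := fun B hB => (mem_heavy.1 hB).1
  have hmn' : (m : ℝ) ≤ n := by exact_mod_cast hmn
  have hm0 : (0 : ℝ) < m := by exact_mod_cast hm
  have hd : (0 : ℝ) < n - m + 1 := by linarith
  have hcardV : (Fintype.card (α → Bool) : ℝ) = 2 ^ n := by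
    rw [Fintype.card_fun, Fintype.card_bool]; push_cast; rfl
  rw [hcardV]
  set G : Finset (Finset α) := {C : Finset α | U ≤ updeg F C} with hG
  have hGd : ∀ C ∈ G, U ≤ updeg F C := fun C hC => (mem_filter.1 hC).2
  have hGm : ∀ C ∈ G, #C = m - 1 := fun C hC => card_eq_of_updeg_pos hF (by
    have := hU.trans_le (hGd C hC)
    exact_mod_cast this)
  refine ⟨_, le_of_le_of_eq (card_most_heavy_fails_le s hL zero_le_one hU ht0 G hGm hGd) (by
    rw [one_add_one_eq_two]), fun x hx => ?_⟩
  rw [mem_filter, not_and, not_lt, one_mul] at hx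
  have hx' := hx (mem_univ _)
  have hc : (0 : ℝ) < n.choose m := by exact_mod_cast Nat.choose_pos hmn
  have hc' : (0 : ℝ) < n.choose (m - 1) := by exact_mod_cast Nat.choose_pos (by omega)
  have hcard : ∀ H : Finset (Finset α), (∀ C ∈ H, #C = m - 1) → (#H : ℝ) ≤ n.choose (m - 1) := by
    intro H hH
    have : #H ≤ n.choose (m - 1) := by
      rw [hn, ← card_univ, ← card_powersetCard]
      exact card_le_card fun B hB => mem_powersetCard.2 ⟨subset_univ _, hH B hB⟩
    exact_mod_cast this
  have hGle : (#G : ℝ) / n.choose (m - 1) ≤ 1 := by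
    rw [div_le_one hc']
    exact hcard G hGm
  -- At most all (m - 1)-sets have low degree, each absorbing at most U pairs; members of G absorb
  -- at most n - m + 1 each.
  have hpairs : (m * #F : ℝ) ≤ U * n.choose (m - 1) + (n - m + 1) * #G := by
    have h1 := mul_card_le hF U
    have h2 := sum_updeg_filter_le hm hmn hF U
    have h3 := hcard {C : Finset α | 1 ≤ updeg F C ∧ (updeg F C : ℝ) < U}
      fun C hC => card_eq_of_updeg_pos hF (mem_filter.1 hC).2.1
    have h4 := mul_le_mul_of_nonneg_left h3 hU.le
    linarith
  have h1 : (#F : ℝ) / n.choose m ≤ U / (n - m + 1) + #G / n.choose (m - 1) := by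
    have e : (#F : ℝ) / n.choose m = (m * #F) / (n.choose (m - 1) * (n - m + 1)) := by
      rw [choose_pred_mul hm hmn]; field_simp
    rw [e, div_le_iff₀ (by positivity)]
    refine hpairs.trans (le_of_eq ?_)
    field_simp
  have h2 : (1 - t) * (#G / n.choose (m - 1)) ≤
      #(heavy (rowStep x s) L (m - 1)) / n.choose (m - 1) := by
    rw [← mul_div_assoc]
    gcongr
  nlinarith

end Dichotomies

/-! ### The growth, densification and final phases. -/

section Phases

variable {n : ℕ}

/-- The possible values of the potential of a state after `k` rows: a threshold `g ^ j` costs the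
sparsity of the minors above it plus the number `k - j` of rows without growth. -/
def potentialValues (n : ℕ) (g : ℝ) (k : ℕ) (s : Finset (Fin n) → ℝ) : Set ℝ :=
  {φ | ∃ j ≤ k, (heavy s (g ^ j) (n - k)).Nonempty ∧
    φ = logSparsity n (n - k) #(heavy s (g ^ j) (n - k)) + ((k : ℝ) - j)}

lemma potentialValues_finite (g : ℝ) (k : ℕ) (s : Finset (Fin n) → ℝ) :
    (potentialValues n g k s).Finite := by
  refine ((Set.finite_Iic k).image fun j : ℕ =>
    logSparsity n (n - k) #(heavy s (g ^ j) (n - k)) + ((k : ℝ) - j)).subset ?_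
  rintro φ ⟨j, hj, _, rfl⟩
  exact ⟨j, hj, rfl⟩

lemma logSparsity_heavy_nonneg {s : Finset (Fin n) → ℝ} {L : ℝ} {m : ℕ}
    (hne : (heavy s L m).Nonempty) : 0 ≤ logSparsity n m #(heavy s L m) := by
  have := logSparsity_nonneg m (heavy s L m) (fun B hB => (mem_heavy.1 hB).1) hne
  rwa [Fintype.card_fin] at this

lemma nonneg_of_mem_potentialValues {g : ℝ} {k : ℕ} {s : Finset (Fin n) → ℝ} {φ : ℝ}
    (h : φ ∈ potentialValues n g k s) : 0 ≤ φ := by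
  obtain ⟨j, hj, hne, rfl⟩ := h
  have : (j : ℝ) ≤ k := by exact_mod_cast hj
  linarith [logSparsity_heavy_nonneg hne]

lemma sInf_potentialValues_le {g : ℝ} {k : ℕ} {s : Finset (Fin n) → ℝ} {φ : ℝ}
    (h : φ ∈ potentialValues n g k s) : sInf (potentialValues n g k s) ≤ φ :=
  csInf_le (potentialValues_finite g k s).bddBelow h

lemma sum_decay_le {k r m : ℕ} (h : k + r + m ≤ n) :
    ∑ j ∈ Ico k (k + r), 2 * (9 / 10 : ℝ) ^ (n - j) ≤ 2 * n * (9 / 10) ^ m := by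
  calc ∑ j ∈ Ico k (k + r), 2 * (9 / 10 : ℝ) ^ (n - j)
      ≤ ∑ j ∈ Ico k (k + r), 2 * (9 / 10 : ℝ) ^ m := by
        refine sum_le_sum fun j hj => ?_
        rw [mem_Ico] at hj
        have : (9 / 10 : ℝ) ^ (n - j) ≤ (9 / 10) ^ m :=
          pow_le_pow_of_le_one (by norm_num) (by norm_num) (by omega)
        linarith
    _ = r * (2 * (9 / 10) ^ m) := by simp
    _ ≤ n * (2 * (9 / 10) ^ m) := by
        gcongr
        omega
    _ = _ := by ring

lemma log_div_four_eq {x : ℝ} (hx : 0 < x) : Real.log (x / 4) = Real.log x - Real.log 4 :=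
  Real.log_div hx.ne' (by norm_num)

/-- One step of the growth phase. -/
lemma exists_rows_growth {k : ℕ} (hkr : k < n) {b g : ℝ} (hb : 2 ≤ b)
    (hb9 : 9 ≤ Real.log (b ^ 2 / 4)) (hg : g = √n / b ^ 4) (hg1 : 1 ≤ g)
    (s : Finset (Fin n) → ℝ) (hs : (potentialValues n g k s).Nonempty) :
    ∃ O : Finset (Fin n → Bool),
      (#Oᶜ : ℝ) ≤ 2 * (9 / 10) ^ (n - k) * Fintype.card (Fin n → Bool) ∧
      (∀ x ∈ O, (potentialValues n g (k + 1) (rowStep x s)).Nonempty) ∧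
      ∑ x ∈ O, sInf (potentialValues n g (k + 1) (rowStep x s)) ≤
        Fintype.card (Fin n → Bool) * (sInf (potentialValues n g k s) +
          (12 / b + if (k : ℝ) + 1 < n / b then 4 else 0)) := by
  have hb0 : 0 < b := by linarith
  have hn0 : (0 : ℝ) < n := by exact_mod_cast (by omega : 0 < n)
  set m := n - k with hm
  have hm1 : 1 ≤ m := by omega
  have hmn : m ≤ Fintype.card (Fin n) := by rw [Fintype.card_fin]; omega
  have hkm : n - (k + 1) = m - 1 := by omega
  have hkm' : (n : ℝ) - m + 1 = k + 1 := by
    rw [hm, Nat.cast_sub (by omega)]; ring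
  obtain ⟨j, hj, hne, hφ⟩ := hs.csInf_mem (potentialValues_finite g k s)
  rw [← hm] at hne hφ
  generalize sInf (potentialValues n g k s) = Φ at hφ ⊢
  set l := logSparsity n m #(heavy s (g ^ j) m) with hl
  have hj' : (j : ℝ) ≤ k := by exact_mod_cast hj
  have hl0 : 0 ≤ l := logSparsity_heavy_nonneg hne
  have hlΦ : l ≤ Φ := by linarith
  have hOval : ∀ x ∈ stableRows s (g ^ j) m, (heavy (rowStep x s) (g ^ j) (m - 1)).Nonempty ∧
      sInf (potentialValues n g (k + 1) (rowStep x s)) ≤ Φ + 4 := by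
    intro x hx
    obtain ⟨h1, h2⟩ := logSparsity_of_mem_stableRows hm1 hmn hne hx
    rw [Fintype.card_fin] at h2
    refine ⟨h1, (sInf_potentialValues_le ⟨j, by omega, by rwa [hkm], rfl⟩).trans ?_⟩
    rw [hkm, hφ]
    push_cast
    linarith
  refine ⟨stableRows s (g ^ j) m, card_stableRows_compl_le s _ hm1 hmn, fun x hx => ?_, ?_⟩
  · exact ⟨_, j, by omega, by rw [hkm]; exact (hOval x hx).1, rfl⟩
  -- In the first rows the possible gain θ(k + 1) / K may be below b ^ 2. They are at most n / b in
  -- number, so each simply pays the worst case: 3 for sparsity and 1 for a row without growth.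
  by_cases hk : ((k : ℝ) + 1) < n / b
  · have := sum_le_of_two_bounds (stableRows s (g ^ j) m) ∅
      (fun x => sInf (potentialValues n g (k + 1) (rowStep x s)))
      (p := 0) (lo := Φ + 4) (hi := Φ + 4) (by linarith) le_rfl (by simp)
      (fun x hx _ => (hOval x hx).2) (fun x hx => (hOval x hx).2)
    refine this.trans ?_
    rw [if_pos hk]
    have : 0 ≤ 12 / b := by positivity
    refine mul_le_mul_of_nonneg_left ?_ (Nat.cast_nonneg _)
    linarith
  · rw [if_neg hk, add_zero]
    rw [not_lt] at hk
    have hgj : 0 < g ^ j := by positivity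
    have hK : (0 : ℝ) < n / b ^ 4 := by positivity
    have hθ : 1 / b ≤ 1 / 2 := one_div_le_one_div_of_le (by norm_num) hb
    rcases exists_rows_logSparsity s (g := g) (K := n / b ^ 4) (θ := 1 / b) hgj (by linarith)
      hK (by positivity) hθ hm1 hmn hne with ⟨W, hW, hW'⟩ | ⟨hlow, W, hW, hW'⟩
    -- K = n / b ^ 4 gives √K = g b ^ 2, so growth by g fails with probability at most 2 / b. The
    -- drift 12 / b is 4θ + 4 · (2 / b) with θ = 1 / b.
    · have hπ : (g + 1) / (1 / b * √(n / b ^ 4)) ≤ 2 / b := by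
        have h1 : √(n / b ^ 4) = g * b ^ 2 := by
          rw [Real.sqrt_div' _ (by positivity), show b ^ 4 = (b ^ 2) ^ 2 by ring,
            Real.sqrt_sq (by positivity), hg]
          field_simp
        rw [h1, div_le_div_iff₀ (by positivity) hb0]
        have : 1 / b * (g * b ^ 2) = g * b := by field_simp
        rw [this]
        nlinarith
      have := sum_le_of_two_bounds (stableRows s (g ^ j) m) W
        (fun x => sInf (potentialValues n g (k + 1) (rowStep x s)))
        (p := 2 / b) (lo := Φ + 4 / b) (hi := Φ + 4 / b + 4)
        (add_nonneg (by linarith) (by positivity)) (by linarith)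
        (hW.trans (by gcongr)) (fun x _ hx => ?_) (fun x hx => ?_)
      · refine this.trans ?_
        refine mul_le_mul_of_nonneg_left ?_ (Nat.cast_nonneg _)
        rw [show (12 : ℝ) / b = 4 / b + 2 / b * 4 by ring]
        linarith
      · obtain ⟨h1, h2⟩ := hW' x hx
        rw [Fintype.card_fin, ← pow_succ'] at h2
        rw [← pow_succ'] at h1
        refine (sInf_potentialValues_le ⟨j + 1, by omega, by rwa [hkm], rfl⟩).trans ?_
        rw [hkm, hφ]
        push_cast
        rw [show (4 : ℝ) / b = 4 * (1 / b) by ring]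
        linarith
      · have h4b : (0 : ℝ) ≤ 4 / b := by positivity
        linarith [(hOval x hx).2]
    · rw [Fintype.card_fin, hkm'] at hlow hW'
      have hgain : b ^ 2 ≤ 1 / b * ((k : ℝ) + 1) / (n / b ^ 4) := by
        rw [le_div_iff₀ hK]
        calc b ^ 2 * (n / b ^ 4) = 1 / b * (n / b) := by field_simp
          _ ≤ _ := by gcongr
      have hlog1 : Real.log (b ^ 2) ≤ l :=
        (Real.log_le_log (by positivity) hgain).trans hlow
      have hlog2 : Real.log (b ^ 2 / 4) ≤
          Real.log (1 / b * ((k : ℝ) + 1) / (4 * (n / b ^ 4))) := by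
        refine Real.log_le_log (by positivity) ?_
        rw [mul_comm 4 (n / b ^ 4), ← div_div]
        gcongr
      have hlog3 := log_div_four_eq (x := b ^ 2) (by positivity)
      have hlog4 : 0 ≤ Real.log 4 := Real.log_nonneg (by norm_num)
      -- The constant 9 is what makes the drift nonpositive: with probability at least 1/3 the
      -- potential falls by at least 9 - 1 = 8, and otherwise it rises by at most 4.
      have := sum_le_of_two_bounds (stableRows s (g ^ j) m) W
        (fun x => sInf (potentialValues n g (k + 1) (rowStep x s)))
        (p := 2 / 3) (lo := Φ + 1 - Real.log (b ^ 2 / 4)) (hi := Φ + 4) (by linarith)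
        (by linarith) hW (fun x _ hx => ?_) (fun x hx => (hOval x hx).2)
      · refine this.trans ?_
        have : (0 : ℝ) ≤ 12 / b := by positivity
        refine mul_le_mul_of_nonneg_left ?_ (Nat.cast_nonneg _)
        linarith
      · obtain ⟨h1, h2⟩ := hW' x hx
        refine (sInf_potentialValues_le ⟨j, by omega, by rwa [hkm], rfl⟩).trans ?_
        rw [hkm, hφ]
        push_cast
        linarith

/-- **Growth phase**: after `r` rows, the minors of some size close to `√n ^ r` are dense. -/
lemma failProb_growth_le {r : ℕ} (hr : r ≤ n) {b g T : ℝ} (hb : 2 ≤ b)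
    (hb9 : 9 ≤ Real.log (b ^ 2 / 4)) (hg : g = √n / b ^ 4) (hg1 : 1 ≤ g) (hT : 0 < T) :
    failProb rowStep (fun s => (potentialValues n g r s).Nonempty ∧
      sInf (potentialValues n g r s) < T) r (initState n) ≤
      2 * n * (9 / 10) ^ (n - r) + 16 * n / (b * T) := by
  have hb0 : 0 < b := by linarith
  have hn0 : (0 : ℝ) < n := by
    rcases Nat.eq_zero_or_pos n with h | h
    · subst h; simp at hg; linarith
    · exact_mod_cast h
  let c : ℕ → ℝ := fun k => 12 / b + if ((k : ℝ) + 1) < n / b then 4 else 0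
  have hinit : (0 : ℝ) ∈ potentialValues n g 0 (initState n) := by
    refine ⟨0, le_rfl, ⟨univ, mem_heavy.2 ⟨by simp, by simp [initState]⟩⟩, ?_⟩
    have : heavy (initState n) (g ^ 0) (n - 0) = {univ} := by
      ext B
      rw [mem_heavy, mem_singleton]
      constructor
      · intro h
        exact (card_eq_iff_eq_univ B).1 (by simpa using h.1)
      · rintro rfl
        exact ⟨by simp, by simp [initState]⟩
    rw [this]
    simp [logSparsity]
  have hmain := failProb_le_of_potential (V := Fin n → Bool) rowStep
    (fun k s => (potentialValues n g k s).Nonempty)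
    (fun k s => sInf (potentialValues n g k s)) hT (fun k => 2 * (9 / 10) ^ (n - k)) c
    (fun k => by positivity) (fun k => by simp only [c]; positivity)
    (fun k s hs => nonneg_of_mem_potentialValues
      (hs.csInf_mem (potentialValues_finite g k s))) 0 r ?_ (initState n) ⟨0, hinit⟩
  · rw [zero_add] at hmain
    refine hmain.trans (add_le_add ?_ ?_)
    · have := sum_decay_le (n := n) (k := 0) (r := r) (m := n - r) (by omega)
      simpa using this
    · have h1 : ∑ j ∈ Ico 0 r, c j ≤ 16 * n / b := by
        simp only [c]
        rw [sum_add_distrib, sum_const, ← sum_filter, sum_const, nsmul_eq_mul, nsmul_eq_mul,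
          Nat.card_Ico]
        have h2 : (#{k ∈ Ico 0 r | ((k : ℕ) : ℝ) + 1 < n / b} : ℝ) ≤ n / b := by
          refine le_trans ?_ (Nat.floor_le (by positivity : 0 ≤ (n : ℝ) / b))
          norm_cast
          rw [← card_range ⌊(n : ℝ) / b⌋₊]
          refine card_le_card fun k hk => ?_
          rw [mem_filter] at hk
          rw [mem_range]
          refine Nat.lt_of_succ_le (Nat.le_floor ?_)
          exact_mod_cast hk.2.le
        have h3 : ((r - 0 : ℕ) : ℝ) ≤ n := by exact_mod_cast (by omega : r - 0 ≤ n)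
        calc _ ≤ n * (12 / b) + n / b * 4 := by gcongr
          _ = _ := by ring
      rw [mul_comm b T, ← div_div, div_right_comm]
      gcongr
      linarith [sInf_potentialValues_le hinit]
  · intro k _ hkr s hs _
    rw [zero_add] at hkr
    exact exists_rows_growth (by omega) hb hb9 hg hg1 s hs

lemma sum_inv_le_log {k r : ℕ} (h : k + r + 1 ≤ n) :
    ∑ j ∈ Ico k (k + r), (1 : ℝ) / ((n - j : ℕ) - 1) ≤ 1 + Real.log n := by
  refine le_trans ?_ (harmonic_le_one_add_log n)
  rw [harmonic_eq_sum_Icc]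
  push_cast
  have : ∑ j ∈ Ico k (k + r), (1 : ℝ) / ((n - j : ℕ) - 1) =
      ∑ i ∈ (Ico k (k + r)).image (fun j => n - j - 1), (i : ℝ)⁻¹ := by
    rw [sum_image]
    · refine sum_congr rfl fun j hj => ?_
      rw [mem_Ico] at hj
      rw [one_div, Nat.cast_sub (show 1 ≤ n - j by omega)]
      push_cast
      rfl
    · intro i hi j hj hij
      simp only [coe_Ico, Set.mem_Ico] at hi hj
      simp only at hij
      omega
  rw [this]
  refine sum_le_sum_of_subset_of_nonneg ?_ fun _ _ _ => by positivity
  intro i hi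
  obtain ⟨j, hj, rfl⟩ := mem_image.1 hi
  rw [mem_Ico] at hj
  rw [mem_Icc]
  omega

/-- One step of the densification phase. -/
lemma exists_rows_densify {q : ℕ} (hq2 : 2 ≤ q) (hqn : q ≤ n) {L U θ t : ℝ}
    (hL : 0 < L) (hU : 0 < U) (hθ0 : 0 < θ) (hθ : θ ≤ 1 / 2) (ht0 : 0 < t) (ht : t ≤ 1 / 2)
    (hlog : Real.log (4 * U / θ) ≤ Real.log n / 2) (hn : 18 ≤ Real.log n)
    (s : Finset (Fin n) → ℝ) (hs : (heavy s L q).Nonempty)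
    (hDq : defect n q #(heavy s L q) / q ≤ 1) :
    ∃ O : Finset (Fin n → Bool),
      (#Oᶜ : ℝ) ≤ 2 * (9 / 10) ^ q * Fintype.card (Fin n → Bool) ∧
      (∀ x ∈ O, (heavy (rowStep x s) L (q - 1)).Nonempty) ∧
      ∑ x ∈ O, defect n (q - 1) #(heavy (rowStep x s) L (q - 1)) / (q - 1 : ℕ) ≤
        Fintype.card (Fin n → Bool) * (defect n q #(heavy s L q) / q +
          (2 * θ * (1 + Real.log n) + 2 * t + 8 / (t * √U)) * (1 / ((q : ℝ) - 1))) := by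
  have hlog0 : 0 < Real.log n := by linarith
  have hqn : q ≤ Fintype.card (Fin n) := by rwa [Fintype.card_fin]
  have hq2' : (2 : ℝ) ≤ q := by exact_mod_cast hq2
  have hq0 : (0 : ℝ) < q := by linarith
  have hq1 : (0 : ℝ) < (q : ℝ) - 1 := by linarith
  have e4 : ((q - 1 : ℕ) : ℝ) = (q : ℝ) - 1 := by rw [Nat.cast_sub (by omega)]; simp
  simp only [e4]
  have hD0 : 0 ≤ defect n q #(heavy s L q) := by
    have := defect_nonneg q (heavy s L q) (fun B hB => (mem_heavy.1 hB).1) hs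
    rwa [Fintype.card_fin] at this
  have hOval : ∀ x ∈ stableRows s L q, (heavy (rowStep x s) L (q - 1)).Nonempty ∧
      defect n (q - 1) #(heavy (rowStep x s) L (q - 1)) ≤ defect n q #(heavy s L q) + 3 := by
    intro x hx
    have := defect_of_mem_stableRows (by omega) hqn hs hx
    rwa [Fintype.card_fin] at this
  refine ⟨stableRows s L q, card_stableRows_compl_le s _ (by omega) hqn,
    fun x hx => (hOval x hx).1, ?_⟩
  rw [← sum_div, div_le_iff₀ hq1]
  set D := defect n q #(heavy s L q)
  set ζ : ℝ := 2 * θ * (1 + Real.log n) + 2 * t + 8 / (t * √U) with hζ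
  have hζ0 : 0 ≤ ζ := by positivity
  -- The contraction 1 - 1/q of the robust shadow bound is exactly offset by dividing by q - 1
  -- instead of q, so defect per element is the right potential.
  have hDid : D / q * (q - 1) = (1 - 1 / q) * D := by field_simp
  have hgoal : (D / q + ζ * (1 / (q - 1))) * (q - 1) = (1 - 1 / q) * D + ζ := by
    rw [add_mul, hDid]; field_simp
  rw [mul_assoc, hgoal]
  have hDid2 : (1 - 1 / q) * D = D - D / q := by ring
  rcases exists_rows_defect s hL hU hθ0 hθ ht0 ht (by omega : 1 ≤ q) hs with
    ⟨W, hW, hW'⟩ | ⟨hlow, W, hW, hW'⟩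
  · rw [Fintype.card_fin] at hW'
    have h8 : 8 / (t * √U) = 2 / (t * √U) * 4 := by ring
    have hp : 0 ≤ 2 * θ * (1 + Real.log n) + 2 * t := by positivity
    have hDq0 : 0 ≤ (1 - 1 / q) * D := by
      rw [← hDid]; positivity
    have := sum_le_of_two_bounds (stableRows s L q) W
      (fun x => defect n (q - 1) #(heavy (rowStep x s) L (q - 1)))
      (p := 2 / (t * √U)) (lo := (1 - 1 / q) * D + 2 * θ * (1 + Real.log n) + 2 * t)
      (hi := (1 - 1 / q) * D + 2 * θ * (1 + Real.log n) + 2 * t + 4) (by linarith)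
      (by linarith) hW (fun x _ hx => hW' x hx)
      (fun x hx => by linarith [(hOval x hx).2])
    refine this.trans ?_
    refine mul_le_mul_of_nonneg_left ?_ (Nat.cast_nonneg _)
    rw [hζ, h8]
    linarith
  · rw [Fintype.card_fin] at hW' hlow
    -- With probability at least 1/3 the defect drops by at least log n / 2 ≥ 9, otherwise it rises
    -- by at most 3; the mean is at most D - 1 ≤ D - D / q, since D / q ≤ 1.
    have := sum_le_of_two_bounds (stableRows s L q) W
      (fun x => defect n (q - 1) #(heavy (rowStep x s) L (q - 1)))
      (p := 2 / 3) (lo := D - (Real.log n - Real.log (4 * U / θ))) (hi := D + 3) (by linarith)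
      (by linarith) hW (fun x _ hx => hW' x hx) (fun x hx => (hOval x hx).2)
    refine this.trans ?_
    refine mul_le_mul_of_nonneg_left ?_ (Nat.cast_nonneg _)
    linarith

/-- **Densification phase**: the density of the heavy minors increases to a constant. -/
lemma failProb_densify_le {k r m : ℕ} (hkr : k + r + m = n) (hm : 1 ≤ m) {L U θ t : ℝ}
    (hL : 0 < L) (hU : 0 < U) (hθ0 : 0 < θ) (hθ : θ ≤ 1 / 2) (ht0 : 0 < t) (ht : t ≤ 1 / 2)
    (hlog : Real.log (4 * U / θ) ≤ Real.log n / 2) (hn : 18 ≤ Real.log n)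
    (s : Finset (Fin n) → ℝ) (hs : (heavy s L (n - k)).Nonempty) :
    failProb rowStep (fun s => (heavy s L m).Nonempty ∧
      defect n m #(heavy s L m) < 1) r s ≤
      2 * n * (9 / 10) ^ m + m * (defect n (n - k) #(heavy s L (n - k)) / (n - k : ℕ) +
        (2 * θ * (1 + Real.log n) + 2 * t + 8 / (t * √U)) * (1 + Real.log n)) := by
  have hm0 : (0 : ℝ) < m := by exact_mod_cast hm
  have hlog0 : 0 < Real.log n := by linarith
  set ζ : ℝ := 2 * θ * (1 + Real.log n) + 2 * t + 8 / (t * √U) with hζ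
  have hζ0 : 0 ≤ ζ := by positivity
  have hdn : ∀ k (s : Finset (Fin n) → ℝ), (heavy s L (n - k)).Nonempty →
      0 ≤ defect n (n - k) #(heavy s L (n - k)) := fun k s h => by
    have := defect_nonneg (n - k) (heavy s L (n - k)) (fun B hB => (mem_heavy.1 hB).1) h
    rwa [Fintype.card_fin] at this
  -- The level T = 1 / m is a final defect of 1, and below it D / q ≤ 1, as each step requires. The
  -- guard k + 2 ≤ n keeps the drift nonnegative at indices past the end, where n - k truncates to
  -- 0.
  have hmain := failProb_le_of_potential (V := Fin n → Bool) rowStep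
    (fun k s => (heavy s L (n - k)).Nonempty)
    (fun k s => defect n (n - k) #(heavy s L (n - k)) / (n - k : ℕ)) (T := 1 / m)
    (by positivity) (fun k => 2 * (9 / 10) ^ (n - k))
    (fun k => if k + 2 ≤ n then ζ * (1 / ((n - k : ℕ) - 1)) else 0)
    (fun k => by positivity) (fun j => ?_)
    (fun k s hs => div_nonneg (hdn k s hs) (Nat.cast_nonneg _)) k r ?_ s hs
  · have e1 : n - (k + r) = m := by omega
    simp only [e1] at hmain
    have e2 : (fun s : Finset (Fin n) → ℝ => (heavy s L m).Nonempty ∧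
        defect n m #(heavy s L m) / m < 1 / m) = fun s => (heavy s L m).Nonempty ∧
        defect n m #(heavy s L m) < 1 := by
      funext s
      rw [div_lt_div_iff_of_pos_right hm0]
    rw [e2] at hmain
    refine hmain.trans (add_le_add (sum_decay_le (by omega)) ?_)
    rw [div_div_eq_mul_div, div_one, mul_comm]
    gcongr
    calc _ = ∑ j ∈ Ico k (k + r), ζ * ((1 : ℝ) / ((n - j : ℕ) - 1)) := by
          refine sum_congr rfl fun j hj => ?_
          rw [mem_Ico] at hj
          rw [if_pos (by omega)]
      _ ≤ _ := by
          rw [← mul_sum]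
          gcongr
          exact sum_inv_le_log (by omega)
  · split_ifs with h
    · have : (1 : ℝ) ≤ (n - j : ℕ) := by exact_mod_cast (by omega : 1 ≤ n - j)
      have h2 : (0 : ℝ) ≤ (n - j : ℕ) - 1 := by linarith
      positivity
    · exact le_rfl
  · intro j hkj hjr s hs hΦ
    rw [if_pos (by omega)]
    simp only [Nat.sub_add_eq n j 1]
    refine exists_rows_densify (by omega) (by omega) hL hU hθ0 hθ ht0 ht hlog hn s hs ?_
    refine hΦ.le.trans ?_
    rw [div_le_one hm0]
    exact_mod_cast hm

/-- **Final phase**: a constant density of heavy minors survives to the last row. -/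
lemma failProb_finish_le {m : ℕ} (hm : 1 ≤ m) (hmn : m ≤ n) {L U t : ℝ}
    (hL : 0 < L) (hU : 0 < U) (ht0 : 0 < t)
    (hUt : U / (n - m + 1) + t ≤ 1 / (12 * m))
    (s : Finset (Fin n) → ℝ) (hs : (heavy s L m).Nonempty) (hdef : defect n m #(heavy s L m) < 1) :
    failProb rowStep (fun s => L ≤ |s ∅|) m s ≤ m * (2 / (t * √U)) := by
  have hm0 : (0 : ℝ) < m := by exact_mod_cast hm
  have hmn' : (m : ℝ) ≤ n := by exact_mod_cast hmn
  have hn0 : (0 : ℝ) < n := by linarith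
  -- A zero potential reduces the maximal inequality to a union bound. The density floor falls by 1
  -- / (12m) per row from 1/3 to 1/4, and positive density at level 0 means that ∅ is heavy.
  have hmain := failProb_le_of_potential (V := Fin n → Bool) rowStep
    (fun k s => 1 / 4 + ((m - k : ℕ) : ℝ) / (12 * m) ≤
      (#(heavy s L (m - k)) : ℝ) / n.choose (m - k)) (fun _ _ => 0) (T := 1) one_pos
    (fun k => 2 / (t * √U)) (fun _ => 0) (fun _ => by positivity) (fun _ => le_rfl)
    (fun _ _ _ => le_rfl) 0 m ?_ s ?_
  · simp only [zero_add, Nat.sub_self, zero_lt_one, and_true] at hmain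
    have hP : (fun s : Finset (Fin n) → ℝ => 1 / 4 + ((0 : ℕ) : ℝ) / (12 * m) ≤
        (#(heavy s L 0) : ℝ) / n.choose 0) = fun s => L ≤ |s ∅| := by
      funext s
      have h0 : heavy s L 0 = if L ≤ |s ∅| then {∅} else ∅ := by
        ext B
        rw [mem_heavy, card_eq_zero]
        split_ifs with h
        · rw [mem_singleton]
          exact ⟨fun h => h.1, fun h' => ⟨h', h' ▸ h⟩⟩
        · simp only [notMem_empty, iff_false]
          rintro ⟨rfl, h'⟩
          exact h h'
      rw [h0]
      split_ifs with h
      · simp only [card_singleton, h, eq_iff_iff, iff_true]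
        norm_num
      · simp only [card_empty, h, eq_iff_iff, iff_false]
        norm_num
    rw [hP] at hmain
    refine hmain.trans (le_of_eq ?_)
    simp
  · intro j _ hj s hs _
    have e3 : m - (j + 1) = m - j - 1 := by omega
    simp only [e3]
    have e5 : ((m - j - 1 : ℕ) : ℝ) = ((m - j : ℕ) : ℝ) - 1 := by
      rw [Nat.cast_sub (by omega)]; simp
    set q := m - j with hq
    have hqm : (q : ℝ) ≤ m := by exact_mod_cast (by omega : q ≤ m)
    obtain ⟨W, hW, hW'⟩ := exists_rows_density s hL hU ht0 (by omega : 1 ≤ q)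
      (by rw [Fintype.card_fin]; omega : q ≤ Fintype.card (Fin n))
    rw [Fintype.card_fin] at hW'
    refine ⟨Wᶜ, by rwa [compl_compl], fun x hx => ?_, by simp⟩
    refine le_trans ?_ (hW' x (mem_compl.1 hx))
    have h1 : U / ((n : ℝ) - q + 1) ≤ U / (n - m + 1) := by
      apply div_le_div_of_nonneg_left hU.le <;> linarith
    rw [e5, sub_div]
    linarith
  · rw [Nat.sub_zero]
    have hN : (0 : ℝ) < #(heavy s L m) := by exact_mod_cast hs.card_pos
    have hc : (0 : ℝ) < n.choose m := by exact_mod_cast Nat.choose_pos hmn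
    -- Defect below 1 means n ^ m < e · m! · #heavy; since e < 3, the initial density is at least
    -- 1/3.
    have h1 : (n : ℝ) ^ m ≤ Real.exp 1 * (m.factorial * #(heavy s L m)) := by
      rw [← Real.log_le_log_iff (by positivity) (by positivity), Real.log_mul (by positivity)
        (by positivity), Real.log_exp, Real.log_pow]
      rw [defect] at hdef
      linarith
    have h2 : (m.factorial * n.choose m : ℝ) ≤ (n : ℝ) ^ m := by
      have := Nat.descFactorial_le_pow n m
      rw [Nat.descFactorial_eq_factorial_mul_choose] at this
      exact_mod_cast this
    have h3 : (m.factorial : ℝ) * n.choose m ≤ m.factorial * (3 * #(heavy s L m)) := by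
      have := Real.exp_one_lt_d9
      have h4 : (0 : ℝ) < m.factorial * #(heavy s L m) := by positivity
      nlinarith
    have h5 : (n.choose m : ℝ) ≤ 3 * #(heavy s L m) := le_of_mul_le_mul_left h3 (by positivity)
    have h6 : (m : ℝ) / (12 * m) = 1 / 12 := by field_simp
    rw [h6, le_div_iff₀ hc]
    linarith

/-- The two measures differ by log(n ^ m / (m! · n.choose m)) ≤ m log(n / (n - m)), which is at most
2m² / n for m ≤ n / 2. -/
lemma defect_le_logSparsity {m : ℕ} (hm : 1 ≤ m) (hmn : 2 * m ≤ n) {N : ℝ} (hN : 0 < N) :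
    defect n m N ≤ 2 * m ^ 2 / n + logSparsity n m N := by
  have hm0 : (0 : ℝ) < m := by exact_mod_cast hm
  have hmn' : (2 * m : ℝ) ≤ n := by exact_mod_cast hmn
  have hn0 : (0 : ℝ) < n := by linarith
  have hc : (0 : ℝ) < n.choose m := by exact_mod_cast Nat.choose_pos (by omega)
  have h1 : ((n : ℝ) - m) ^ m ≤ m.factorial * n.choose m := by
    have := Nat.pow_sub_le_descFactorial n m
    rw [Nat.descFactorial_eq_factorial_mul_choose] at this
    have h2 : (((n + 1 - m : ℕ) : ℝ)) ^ m ≤ m.factorial * n.choose m := by exact_mod_cast this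
    refine le_trans ?_ h2
    have h3 : (n : ℝ) - m ≤ (n + 1 - m : ℕ) := by
      rw [Nat.cast_sub (by omega)]; push_cast; linarith
    gcongr
    linarith
  have hnm : 0 < (n : ℝ) - m := by linarith
  have h2 := Real.log_le_log (by positivity) h1
  rw [Real.log_pow, Real.log_mul (by positivity) hc.ne'] at h2
  have h3 : Real.log n - Real.log (n - m) ≤ 2 * m / n := by
    rw [← Real.log_div hn0.ne' hnm.ne']
    refine (Real.log_le_sub_one_of_pos (by positivity)).trans ?_
    rw [div_sub_one hnm.ne', div_le_div_iff₀ hnm hn0]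
    nlinarith
  have h4 : m * (Real.log n - Real.log (n - m)) ≤ 2 * m ^ 2 / n := by
    calc _ ≤ m * (2 * m / n : ℝ) := by gcongr
      _ = _ := by ring
  unfold defect logSparsity
  rw [Real.log_mul (by positivity) hN.ne']
  linarith

end Phases

/-! ### Choice of parameters and the lower bound. -/

lemma failProb_mono {V S : Type*} [Fintype V] (step : V → S → S) {P Q : S → Prop}
    (h : ∀ s, P s → Q s) (r : ℕ) (s : S) : failProb step Q r s ≤ failProb step P r s := by
  induction r generalizing s with
  | zero =>
    unfold failProb
    by_cases hP : P s
    · simp [hP, h s hP]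
    · rw [if_neg hP]; split_ifs <;> norm_num
  | succ r ih =>
    unfold failProb
    gcongr
    exact ih _

lemma failProb_and_le {V S : Type*} [Fintype V] (step : V → S → S) (P Q : S → Prop)
    (r : ℕ) (s : S) :
    failProb step (fun s => P s ∧ Q s) r s ≤ failProb step P r s + failProb step Q r s := by
  induction r generalizing s with
  | zero =>
    unfold failProb
    by_cases hP : P s <;> by_cases hQ : Q s <;> simp [hP, hQ]
  | succ r ih =>
    unfold failProb
    rw [← add_div, ← sum_add_distrib]
    gcongr
    exact ih _

lemma failProb_finish_of_pow_le {n m : ℕ} {a : ℝ} (ha : 60 ≤ a) (han : a ^ 11 ≤ n) (hm : a ≤ m)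
    (hm' : m ≤ 2 * a) (hmn : 2 * m ≤ n) {L : ℝ} (hL : 0 < L) (s : Finset (Fin n) → ℝ)
    (hs : (heavy s L m).Nonempty) (hdef : defect n m #(heavy s L m) < 1) :
    failProb rowStep (fun s => L ≤ |s ∅|) m s ≤ 4 / a := by
  have ha0 : 0 < a := by linarith
  have hm0 : (0 : ℝ) < m := by linarith
  have hm1 : 1 ≤ m := by exact_mod_cast hm0
  have h1 : (n : ℝ) / 2 ≤ n - m + 1 := by
    have : (2 * m : ℝ) ≤ n := by exact_mod_cast hmn
    linarith
  have hnm : 0 < (n : ℝ) - m + 1 := by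
    have : 0 < a ^ 11 := by positivity
    linarith
  have h2 : a ^ 8 / (n - m + 1) ≤ 1 / (48 * a) := by
    rw [div_le_div_iff₀ hnm (by positivity)]
    have h3 : a ^ 8 * (48 * a) * 2 ≤ n := by
      calc a ^ 8 * (48 * a) * 2 = a ^ 9 * 96 := by ring
        _ ≤ a ^ 9 * a ^ 2 := by gcongr; nlinarith
        _ = a ^ 11 := by ring
        _ ≤ n := han
    linarith
  have h4 : 1 / a ^ 2 ≤ 1 / (48 * a) := by
    apply one_div_le_one_div_of_le (by positivity)
    nlinarith
  have h5 : 1 / (24 * a) ≤ 1 / (12 * (m : ℝ)) := by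
    apply one_div_le_one_div_of_le (by positivity)
    linarith
  have h6 : 1 / (24 * a) = 1 / (48 * a) + 1 / (48 * a) := by field_simp; norm_num
  -- These choices give failure probability 2 / (t√U) = 2 / a ^ 2 per row over at most 2a rows, and
  -- keep the density loss within 1 / (24a) ≤ 1 / (12m).
  have hfin := failProb_finish_le (n := n) hm1 (by omega) hL (U := a ^ 8) (t := 1 / a ^ 2)
    (by positivity) (by positivity) (by linarith) s hs hdef
  refine hfin.trans ?_
  have h7 : √(a ^ 8) = a ^ 4 := by
    rw [show a ^ 8 = (a ^ 4) ^ 2 by ring, Real.sqrt_sq (by positivity)]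
  rw [h7]
  calc (m : ℝ) * (2 / (1 / a ^ 2 * a ^ 4)) ≤ 2 * a * (2 / (1 / a ^ 2 * a ^ 4)) := by gcongr
    _ = 4 / a := by field_simp; norm_num

lemma decay_le {n N m : ℕ} {a : ℝ} (han : a ^ N = n) (hm : a ≤ m) :
    2 * (n : ℝ) * (9 / 10) ^ m ≤ 2 * (a ^ N * (9 / 10) ^ a) := by
  have h1 : ((9 : ℝ) / 10) ^ m ≤ (9 / 10) ^ a := by
    rw [← Real.rpow_natCast]
    exact Real.rpow_le_rpow_of_exponent_ge (by norm_num) (by norm_num) hm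
  rw [han, ← mul_assoc]
  gcongr

/-- The initial defect per element is at most 5 / a ^ 3 and the accumulated drift is O(N² / a ^ 3);
the factor m₂ ≤ 2a, the reciprocal of the target level, leaves O(N² / a ^ 2). -/
lemma densify_error_le {N m₁ m₂ : ℕ} {a n d l : ℝ} (ha : 0 < a) (hn : 0 < n)
    (hl0 : 0 ≤ l) (hl : l ≤ 2 * N * a) (hm₂ : (m₂ : ℝ) ≤ 2 * a) (hm₁ : n / a ^ 3 ≤ m₁)
    (hm₁' : (m₁ : ℝ) ≤ 2 * (n / a ^ 3)) (hd : d ≤ 2 * (m₁ : ℝ) ^ 2 / n + n / a ^ 6) :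
    (m₂ : ℝ) * (d / m₁ +
      (2 * (1 / a ^ 5) * l + 2 * (1 / a ^ 4) + 8 / (1 / a ^ 4 * √(a ^ 16))) * l) ≤
      (10 + 4 * N * (4 * N + 10)) / a ^ 2 := by
  have hm₁0 : (0 : ℝ) < m₁ := lt_of_lt_of_le (by positivity) hm₁
  have hdef : d / m₁ ≤ 5 / a ^ 3 := by
    rw [div_le_iff₀ hm₁0]
    have h2 : 2 * (m₁ : ℝ) ^ 2 / n ≤ 4 / a ^ 3 * m₁ := by
      calc 2 * (m₁ : ℝ) ^ 2 / n = 2 * m₁ / n * m₁ := by ring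
        _ ≤ 2 * (2 * (n / a ^ 3)) / n * m₁ := by gcongr
        _ = 4 / a ^ 3 * m₁ := by field_simp; norm_num
    have h3 : n / a ^ 6 ≤ 1 / a ^ 3 * m₁ := by
      calc n / a ^ 6 = 1 / a ^ 3 * (n / a ^ 3) := by field_simp
        _ ≤ _ := by gcongr
    have h4 : 5 / a ^ 3 * m₁ = 4 / a ^ 3 * m₁ + 1 / a ^ 3 * m₁ := by ring
    linarith
  have h1 : √(a ^ 16) = a ^ 8 := by
    rw [show a ^ 16 = (a ^ 8) ^ 2 by ring, Real.sqrt_sq (by positivity)]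
  rw [h1]
  have hζ : 2 * (1 / a ^ 5) * l + 2 * (1 / a ^ 4) + 8 / (1 / a ^ 4 * a ^ 8) ≤
      (4 * N + 10) / a ^ 4 := by
    calc _ ≤ 2 * (1 / a ^ 5) * (2 * N * a) + 2 * (1 / a ^ 4) + 8 / (1 / a ^ 4 * a ^ 8) := by
          gcongr
      _ = _ := by field_simp; ring
  calc _ ≤ (m₂ : ℝ) * (5 / a ^ 3 + (4 * N + 10) / a ^ 4 * (2 * N * a)) := by
        gcongr
    _ ≤ 2 * a * (5 / a ^ 3 + (4 * N + 10) / a ^ 4 * (2 * N * a)) := by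
        gcongr
    _ = _ := by field_simp; ring

lemma failProb_densify_of_pow_le {n N m₁ m₂ : ℕ} (hN : 100 ≤ N) {a : ℝ} (ha : 60 ≤ a)
    (han : a ^ N = n) (hm₁ : (n : ℝ) / a ^ 3 ≤ m₁) (hm₁' : (m₁ : ℝ) ≤ 2 * (n / a ^ 3))
    (hm₂ : a ≤ m₂) (hm₂' : (m₂ : ℝ) ≤ 2 * a) (hm₁₂ : m₂ ≤ m₁) (hmn : 2 * m₁ ≤ n) {L : ℝ}
    (hL : 0 < L) (s : Finset (Fin n) → ℝ) (hs : (heavy s L m₁).Nonempty)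
    (hls : logSparsity n m₁ #(heavy s L m₁) ≤ n / a ^ 6) :
    failProb rowStep (fun s => (heavy s L m₂).Nonempty ∧ defect n m₂ #(heavy s L m₂) < 1)
      (m₁ - m₂) s ≤
      2 * (a ^ N * (9 / 10) ^ a) + (10 + 4 * N * (4 * N + 10)) / a ^ 2 := by
  have ha0 : 0 < a := by linarith
  have ha1 : 1 ≤ a := by linarith
  have hn0 : (0 : ℝ) < n := han ▸ by positivity
  have hNr : (100 : ℝ) ≤ N := by exact_mod_cast hN
  have hloga : 1 ≤ Real.log a := by
    rw [Real.le_log_iff_exp_le ha0]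
    linarith [Real.exp_one_lt_d9]
  have hlogn : Real.log n = N * Real.log a := by rw [← han, Real.log_pow]
  have hlogn18 : 18 ≤ Real.log n := by rw [hlogn]; nlinarith
  have hlognle : 1 + Real.log n ≤ 2 * N * a := by
    rw [hlogn]
    have := Real.log_le_sub_one_of_pos ha0
    nlinarith
  have hm₂1 : 1 ≤ m₂ := by
    have : (0 : ℝ) < m₂ := by linarith
    exact_mod_cast this
  have hrm : n - (n - m₁) = m₁ := by omega
  have hhalf : ∀ i : ℕ, i ≠ 0 → 1 / a ^ i ≤ 1 / 2 := fun i hi =>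
    one_div_le_one_div_of_le (by norm_num) (by linarith [le_self_pow₀ ha1 hi])
  -- 4U / θ ≤ a ^ 22, well below √n = a ^ (N / 2) because N ≥ 100.
  have hlogU : Real.log (4 * a ^ 16 / (1 / a ^ 5)) ≤ Real.log n / 2 := by
    have h1 : 4 * a ^ 16 / (1 / a ^ 5) ≤ a ^ 22 := by
      rw [div_div_eq_mul_div, div_one]
      calc 4 * a ^ 16 * a ^ 5 = a ^ 21 * 4 := by ring
        _ ≤ a ^ 21 * a := by gcongr; linarith
        _ = a ^ 22 := by ring
    have h2 := Real.log_le_log (by positivity) h1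
    rw [Real.log_pow] at h2
    rw [hlogn]
    push_cast at h2
    nlinarith
  have hdens := failProb_densify_le (n := n) (k := n - m₁) (r := m₁ - m₂) (m := m₂) (by omega)
    hm₂1 hL (U := a ^ 16) (θ := 1 / a ^ 5) (t := 1 / a ^ 4) (by positivity) (by positivity)
    (hhalf 5 (by norm_num)) (by positivity) (hhalf 4 (by norm_num)) hlogU hlogn18 s
    (by rwa [hrm])
  rw [hrm] at hdens
  refine hdens.trans (add_le_add (decay_le han hm₂) ?_)
  refine densify_error_le ha0 hn0 (by linarith) hlognle hm₂' hm₁ hm₁' ?_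
  have := defect_le_logSparsity (n := n) (m := m₁) (by omega) hmn
    (show (0 : ℝ) < #(heavy s L m₁) by exact_mod_cast hs.card_pos)
  linarith

lemma failProb_last_phases_le {n N m₁ m₂ : ℕ} (hN : 100 ≤ N) {a : ℝ} (ha : 60 ≤ a)
    (han : a ^ N = n) (hm₁ : (n : ℝ) / a ^ 3 ≤ m₁) (hm₁' : (m₁ : ℝ) ≤ 2 * (n / a ^ 3))
    (hm₂ : a ≤ m₂) (hm₂' : (m₂ : ℝ) ≤ 2 * a) (hm₁₂ : m₂ ≤ m₁) (hmn : 2 * m₁ ≤ n) {L : ℝ}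
    (hL : 0 < L) (s : Finset (Fin n) → ℝ) (hs : (heavy s L m₁).Nonempty)
    (hls : logSparsity n m₁ #(heavy s L m₁) ≤ n / a ^ 6) :
    failProb rowStep (fun s => L ≤ |s ∅|) m₁ s ≤
      2 * (a ^ N * (9 / 10) ^ a) + (10 + 4 * N * (4 * N + 10)) / a ^ 2 + 4 / a := by
  have ha11 : a ^ 11 ≤ n := han ▸ pow_le_pow_right₀ (by linarith) (by omega)
  have hcomb := failProb_add_le rowStep (fun s : Finset (Fin n) → ℝ => L ≤ |s ∅|)
    (fun s => (heavy s L m₂).Nonempty ∧ defect n m₂ #(heavy s L m₂) < 1) (m₁ - m₂) m₂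
    (ε := 4 / a) (by positivity)
    (fun s hs => failProb_finish_of_pow_le ha ha11 hm₂ hm₂' (by omega) hL s hs.1 hs.2) s
  rw [Nat.sub_add_cancel hm₁₂] at hcomb
  linarith [failProb_densify_of_pow_le hN ha han hm₁ hm₁' hm₂ hm₂' hm₁₂ hmn hL s hs hls]

/-- Quantitative lower bound on the permanent of a random sign matrix, for `n = a ^ N`. -/
lemma failProb_lower_le {n N : ℕ} (hN : 100 ≤ N) {a : ℝ} (ha : 60 ≤ a) (han : a ^ N = n) :
    failProb rowStep (fun s => (√n / a ^ 32) ^ ((n : ℝ) * (1 - 3 / a ^ 3)) ≤ |s ∅|) n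
      (initState n) ≤
      4 * (a ^ N * (9 / 10) ^ a) + (26 + 4 * N * (4 * N + 10)) / a ^ 2 + 4 / a := by
  have ha0 : 0 < a := by linarith
  have ha1 : 1 ≤ a := by linarith
  have hpow : ∀ {i : ℕ}, i ≤ N → a ^ i ≤ (n : ℝ) := fun h => han ▸ pow_le_pow_right₀ ha1 h
  have hn0 : (0 : ℝ) < n := han ▸ by positivity
  have hloga : 1 ≤ Real.log a := by
    rw [Real.le_log_iff_exp_le ha0]
    linarith [Real.exp_one_lt_d9]
  have hgb : √(n : ℝ) / a ^ 32 = √n / (a ^ 8) ^ 4 := by rw [← pow_mul]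
  have hg1 : 1 ≤ √(n : ℝ) / a ^ 32 := by
    rw [le_div_iff₀ (by positivity), one_mul]
    apply Real.le_sqrt_of_sq_le
    rw [← pow_mul]
    exact hpow (by omega)
  have hb2 : 2 ≤ a ^ 8 := by linarith [le_self_pow₀ ha1 (show 8 ≠ 0 by norm_num)]
  have hb9 : 9 ≤ Real.log ((a ^ 8) ^ 2 / 4) := by
    have h1 : a ^ 15 ≤ (a ^ 8) ^ 2 / 4 := by
      rw [← pow_mul, le_div_iff₀ (by norm_num)]
      calc a ^ 15 * 4 ≤ a ^ 15 * a := by gcongr; linarith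
        _ = a ^ (8 * 2) := by ring
    have h2 := Real.log_le_log (by positivity) h1
    rw [Real.log_pow] at h2
    push_cast at h2
    linarith
  have hna3 : a ≤ n / a ^ 3 := by
    rw [le_div_iff₀ (by positivity)]
    calc a * a ^ 3 = a ^ 4 := by ring
      _ ≤ (n : ℝ) := hpow (by omega)
  -- Growth stops with m₁ ≈ n / a ^ 3 columns left, densification with m₂ ≈ a. With b = a ^ 8 and T
  -- = n / a ^ 6, the growth error is 16n / (bT) = 16 / a ^ 2.
  obtain ⟨m₁, hm₁, hm₁'⟩ : ∃ m : ℕ, (n : ℝ) / a ^ 3 ≤ m ∧ (m : ℝ) ≤ 2 * (n / a ^ 3) :=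
    ⟨_, Nat.le_ceil _, by
      have := Nat.ceil_lt_add_one (show 0 ≤ (n : ℝ) / a ^ 3 by positivity)
      linarith⟩
  obtain ⟨m₂, hm₂, hm₂', hm₁₂⟩ : ∃ m : ℕ, a ≤ m ∧ (m : ℝ) ≤ 2 * a ∧ m ≤ m₁ :=
    ⟨_, Nat.le_ceil _, by
      have := Nat.ceil_lt_add_one ha0.le
      linarith, Nat.ceil_le.2 (by linarith)⟩
  have hmn : 2 * m₁ ≤ n := by
    have : (2 * m₁ : ℝ) ≤ n := by
      have h1 : (n : ℝ) / a ^ 3 ≤ n / 4 :=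
        div_le_div_of_nonneg_left hn0.le (by norm_num)
          (by linarith [le_self_pow₀ ha1 (show 3 ≠ 0 by norm_num)])
      linarith
    exact_mod_cast this
  have hT0 : 0 < (n : ℝ) / a ^ 6 := by positivity
  have hgrow := failProb_growth_le (n := n) (r := n - m₁) (by omega) hb2 hb9 hgb hg1 hT0
  have hg1' := hg1
  generalize √(n : ℝ) / a ^ 32 = g at hgrow hg1' ⊢
  have hrm : n - (n - m₁) = m₁ := by omega
  have hfinal := failProb_add_le rowStep
    (fun s : Finset (Fin n) → ℝ => g ^ ((n : ℝ) * (1 - 3 / a ^ 3)) ≤ |s ∅|)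
    (fun s => (potentialValues n g (n - m₁) s).Nonempty ∧
      sInf (potentialValues n g (n - m₁) s) < n / a ^ 6) (n - m₁) m₁
    (ε := 2 * (a ^ N * (9 / 10) ^ a) + (10 + 4 * N * (4 * N + 10)) / a ^ 2 + 4 / a)
    (by positivity) (by
      rintro s ⟨hne, hlt⟩
      obtain ⟨j, hj, hh, hφ⟩ := hne.csInf_mem (potentialValues_finite g _ s)
      rw [hφ] at hlt
      have hj' : (j : ℝ) ≤ (n - m₁ : ℕ) := by exact_mod_cast hj
      have hls := logSparsity_heavy_nonneg hh
      have hcast : ((n - m₁ : ℕ) : ℝ) = n - m₁ := by rw [Nat.cast_sub (by omega)]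
      -- Potential below n / a ^ 6 bounds the rows without growth, so j ≥ n - m₁ - n / a ^ 6 with m₁
      -- ≤ 2n / a ^ 3.
      have hjl : (n : ℝ) * (1 - 3 / a ^ 3) ≤ j := by
        have h1 : (n : ℝ) / a ^ 6 ≤ n / a ^ 3 :=
          div_le_div_of_nonneg_left hn0.le (by positivity) (pow_le_pow_right₀ ha1 (by norm_num))
        have h2 : (n : ℝ) * (1 - 3 / a ^ 3) = n - 3 * (n / a ^ 3) := by ring
        rw [h2]
        linarith
      rw [hrm] at hh hlt
      refine (failProb_mono rowStep (fun s' hs' => le_trans ?_ hs') m₁ s).trans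
        (failProb_last_phases_le hN ha han hm₁ hm₁' hm₂ hm₂' hm₁₂ hmn
          (show 0 < g ^ j by positivity) s hh (by linarith))
      rw [← Real.rpow_natCast g j]
      exact Real.rpow_le_rpow_of_exponent_le hg1' hjl) (initState n)
  rw [Nat.sub_add_cancel (by omega)] at hfinal
  refine hfinal.trans ?_
  rw [hrm] at hgrow
  have h1 := decay_le han (hm₂.trans (Nat.cast_le.2 hm₁₂))
  have h2 : 16 * n / (a ^ 8 * (n / a ^ 6)) = 16 / a ^ 2 := by field_simp
  rw [h2] at hgrow
  have h3 : (26 + 4 * N * (4 * N + 10)) / a ^ 2 =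
      16 / a ^ 2 + (10 + 4 * N * (4 * N + 10)) / a ^ 2 := by ring
  rw [h3]
  linarith

lemma tendsto_error_zero (N : ℕ) :
    Tendsto (fun a : ℝ => 4 * (a ^ N * (9 / 10) ^ a) + (26 + 4 * N * (4 * N + 10)) / a ^ 2 + 4 / a)
      atTop (𝓝 0) := by
  have h1 : Tendsto (fun a : ℝ => a ^ N * (9 / 10 : ℝ) ^ a) atTop (𝓝 0) := by
    have hlog : 0 < -Real.log (9 / 10) := by
      have := Real.log_neg (show (0 : ℝ) < 9 / 10 by norm_num) (by norm_num)
      linarith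
    have := tendsto_rpow_mul_exp_neg_mul_atTop_nhds_zero N (-Real.log (9 / 10)) hlog
    refine this.congr fun a => ?_
    rw [Real.rpow_natCast, Real.rpow_def_of_pos (by norm_num), neg_neg]
  have h2 : Tendsto (fun a : ℝ => (26 + 4 * N * (4 * N + 10)) / a ^ 2) atTop (𝓝 0) :=
    tendsto_const_nhds.div_atTop (tendsto_pow_atTop (by norm_num))
  have h3 : Tendsto (fun a : ℝ => 4 / a) atTop (𝓝 0) := tendsto_const_nhds.div_atTop tendsto_id
  simpa using ((h1.const_mul 4).add h2).add h3

/-- The permanent of a random sign matrix is unlikely to be much smaller than `√n ^ n`. -/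
lemma tendsto_failProb_lower {η : ℝ} (hη : 0 < η) :
    Tendsto (fun n : ℕ => failProb rowStep (fun s => (n : ℝ) ^ ((1 / 2 - η) * n) ≤ |s ∅|) n
      (initState n)) atTop (𝓝 0) := by
  -- Dividing √n by a ^ 32 = n ^ (32 / N) loses at most η / 2 in the exponent; the other η / 2 pays
  -- for the factor 1 - 3 / a ^ 3.
  obtain ⟨N, hN⟩ : ∃ N : ℕ, 100 + 64 / η ≤ N := exists_nat_ge _
  have hN100 : 100 ≤ N := by
    have : (100 : ℝ) ≤ N := by linarith [show 0 < 64 / η by positivity]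
    exact_mod_cast this
  have hN0 : (0 : ℝ) < N := by exact_mod_cast (by omega : 0 < N)
  have hNη : 32 / (N : ℝ) ≤ η / 2 := by
    have h1 : 64 / η ≤ N := by linarith
    rw [div_le_iff₀ hη] at h1
    rw [div_le_div_iff₀ hN0 (by norm_num)]
    linarith
  have hroot : Tendsto (fun n : ℕ => (n : ℝ) ^ (1 / (N : ℝ))) atTop atTop :=
    (tendsto_rpow_atTop (by positivity)).comp tendsto_natCast_atTop_atTop
  refine squeeze_zero' (Eventually.of_forall fun n => failProb_nonneg _ _ _ _) ?_
    ((tendsto_error_zero N).comp hroot)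
  have h3 : Tendsto (fun n : ℕ => 3 / ((n : ℝ) ^ (1 / (N : ℝ))) ^ 3) atTop (𝓝 0) :=
    tendsto_const_nhds.div_atTop ((tendsto_pow_atTop (by norm_num)).comp hroot)
  filter_upwards [hroot.eventually_ge_atTop 60, eventually_ge_atTop 1,
    h3.eventually_le_const (show 0 < min (1 : ℝ) η by positivity)] with n hn60 hn1 hn3
  have hn1' : (1 : ℝ) ≤ n := by exact_mod_cast hn1
  set a : ℝ := (n : ℝ) ^ (1 / (N : ℝ)) with ha
  have ha0 : 0 < a := by linarith
  have haN : a ^ N = n := by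
    rw [ha, one_div, Real.rpow_inv_natCast_pow (by positivity) (by omega)]
  refine (failProb_mono rowStep (fun s hs => le_trans ?_ hs) n _).trans
    (failProb_lower_le hN100 hn60 haN)
  have hg : √n / a ^ 32 = (n : ℝ) ^ (1 / 2 - 32 / (N : ℝ)) := by
    rw [Real.rpow_sub (by positivity), Real.sqrt_eq_rpow, ha, ← Real.rpow_natCast,
      ← Real.rpow_mul (by positivity)]
    congr 2
    push_cast
    ring
  rw [hg, ← Real.rpow_mul (by positivity)]
  refine Real.rpow_le_rpow_of_exponent_le hn1' ?_
  set u := 3 / a ^ 3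
  have hu0 : 0 ≤ u := by positivity
  have hu1 : u ≤ 1 := hn3.trans (min_le_left _ _)
  have hu2 : u ≤ η := hn3.trans (min_le_right _ _)
  have hv0 : 0 ≤ 32 / (N : ℝ) := by positivity
  set v := 32 / (N : ℝ)
  have : (1 / 2 - η) ≤ (1 / 2 - v) * (1 - u) := by nlinarith
  calc (1 / 2 - η) * n ≤ ((1 / 2 - v) * (1 - u)) * n := by gcongr
    _ = _ := by ring

/-! ### The second moment and the upper bound. -/

section SecondMoment

variable {α : Type*} [Fintype α] [DecidableEq α]

/-- Orthogonality of the signs: flipping the new coordinate pairs off the cross terms. -/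
lemma sum_sq_sgn_sum (c : α → ℝ) (J : Finset α) :
    ∑ x : α → Bool, (∑ i ∈ J, sgn (x i) * c i) ^ 2 =
      2 ^ Fintype.card α * ∑ i ∈ J, c i ^ 2 := by
  induction J using Finset.induction_on with
  | empty => simp
  | insert a J ha ih =>
    have hcross : ∑ x : α → Bool, sgn (x a) * c a * ∑ i ∈ J, sgn (x i) * c i = 0 := by
      refine sum_involution (fun x _ => Function.update x a (!x a)) ?_ ?_ ?_ ?_
      · intro x _
        have : ∑ i ∈ J, sgn (Function.update x a (!x a) i) * c i = ∑ i ∈ J, sgn (x i) * c i :=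
          sum_congr rfl fun i hi => by
            rw [Function.update_of_ne (ne_of_mem_of_not_mem hi ha)]
        rw [this, Function.update_self, sgn_not]
        ring
      · intro x _ _ h
        have := congrFun h a
        simp at this
      · simp
      · intro x _
        simp
    rw [sum_insert ha, mul_add, ← ih]
    have : ∀ x : α → Bool, (∑ i ∈ insert a J, sgn (x i) * c i) ^ 2 =
        c a ^ 2 + (∑ i ∈ J, sgn (x i) * c i) ^ 2 +
          2 * (sgn (x a) * c a * ∑ i ∈ J, sgn (x i) * c i) := by
      intro x
      rw [sum_insert ha]
      linear_combination (c a ^ 2) * sgn_mul_self (x a)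
    rw [sum_congr rfl fun x _ => this x, sum_add_distrib, sum_add_distrib, ← mul_sum _ _ (2 : ℝ),
      hcross]
    simp

lemma sum_powersetCard_insert (f : Finset α → ℝ) (m : ℕ) :
    ∑ C ∈ powersetCard m univ, ∑ i ∈ Cᶜ, f (insert i C) =
      (m + 1) * ∑ B ∈ powersetCard (m + 1) univ, f B := by
  have : (m + 1) * ∑ B ∈ powersetCard (m + 1) univ, f B =
      ∑ B ∈ powersetCard (m + 1) (univ : Finset α), ∑ _i ∈ B, f B := by
    rw [mul_sum]
    refine sum_congr rfl fun B hB => ?_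
    rw [sum_const, nsmul_eq_mul, (mem_powersetCard.1 hB).2]
    push_cast
    rfl
  rw [this, sum_sigma', sum_sigma']
  refine sum_bij' (fun p _ => ⟨insert p.2 p.1, p.2⟩) (fun p _ => ⟨p.1.erase p.2, p.2⟩)
    ?_ ?_ ?_ ?_ ?_
  · rintro ⟨C, i⟩ h
    simp only [mem_sigma, mem_powersetCard, subset_univ, true_and, mem_compl] at h ⊢
    exact ⟨by rw [card_insert_of_notMem h.2, h.1], mem_insert_self _ _⟩
  · rintro ⟨B, i⟩ h
    simp only [mem_sigma, mem_powersetCard, subset_univ, true_and, mem_compl] at h ⊢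
    exact ⟨by rw [card_erase_of_mem h.2, h.1]; rfl, notMem_erase _ _⟩
  · rintro ⟨C, i⟩ h
    simp only [mem_sigma, mem_compl] at h
    simp [erase_insert h.2]
  · rintro ⟨B, i⟩ h
    simp only [mem_sigma] at h
    simp [insert_erase h.2]
  · rintro ⟨C, i⟩ _
    rfl

lemma sum_sq_rowStep (s : Finset α → ℝ) (m : ℕ) :
    ∑ x : α → Bool, ∑ C ∈ powersetCard m univ, rowStep x s C ^ 2 =
      2 ^ Fintype.card α * ((m + 1) * ∑ B ∈ powersetCard (m + 1) univ, s B ^ 2) := by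
  rw [sum_comm, ← sum_powersetCard_insert (fun B => s B ^ 2), mul_sum]
  exact sum_congr rfl fun C _ => sum_sq_sgn_sum _ _

end SecondMoment

/-- By `sum_sq_rowStep`, (n - k)! times the sum of the squared minors keeps its mean exactly from
row to row. It starts at n! and ends at the squared permanent, so the maximal inequality has no
error terms. -/
lemma failProb_upper_le (n : ℕ) {T : ℝ} (hT : 0 < T) :
    failProb rowStep (fun s => s ∅ ^ 2 < T) n (initState n) ≤ n.factorial / T := by
  have h := failProb_le_of_potential (V := Fin n → Bool) rowStep
    (fun _ (_ : Finset (Fin n) → ℝ) => True)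
    (fun k s => (n - k).factorial * ∑ B ∈ powersetCard (n - k) univ, s B ^ 2) hT
    (fun _ => 0) (fun _ => 0) (fun _ => le_rfl) (fun _ => le_rfl)
    (fun _ _ _ => by positivity) 0 n (fun j _ hj s _ _ => ⟨univ, by simp, by simp, by
      obtain ⟨m, hm⟩ : ∃ m, n - j = m + 1 := ⟨n - j - 1, by omega⟩
      rw [hm, show n - (j + 1) = m by omega, ← mul_sum, sum_sq_rowStep, Nat.factorial_succ]
      simp only [Fintype.card_fin, Fintype.card_fun, Fintype.card_bool, add_zero]
      push_cast
      apply le_of_eq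
      ring⟩) (initState n) trivial
  simpa [initState] using h

/-- The permanent of a random sign matrix is unlikely to be much larger than `√n ^ n`. -/
lemma tendsto_failProb_upper {η : ℝ} (hη : 0 < η) :
    Tendsto (fun n : ℕ => failProb rowStep (fun s => |s ∅| ≤ (n : ℝ) ^ ((1 / 2 + η) * n)) n
      (initState n)) atTop (𝓝 0) := by
  have hlim : Tendsto (fun n : ℕ => (n : ℝ) ^ (-(2 * η))) atTop (𝓝 0) :=
    (tendsto_rpow_neg_atTop (by positivity)).comp tendsto_natCast_atTop_atTop
  refine squeeze_zero' (Eventually.of_forall fun n => failProb_nonneg _ _ _ _) ?_ hlim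
  filter_upwards [eventually_ge_atTop 1] with n hn
  have hn1 : (1 : ℝ) ≤ n := by exact_mod_cast hn
  have hn0 : (0 : ℝ) < n := by linarith
  set U : ℝ := (n : ℝ) ^ ((1 / 2 + η) * n) with hU
  have hU0 : 0 < U := by positivity
  have hU2 : U ^ 2 = (n : ℝ) ^ ((n : ℝ) + 2 * η * n) := by
    rw [hU, ← Real.rpow_mul_natCast hn0.le]
    congr 1
    push_cast
    ring
  refine (failProb_mono rowStep (fun s hs => (abs_lt_of_sq_lt_sq hs hU0.le).le) n _).trans
    ((failProb_upper_le n (T := U ^ 2) (by positivity)).trans ?_)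
  rw [hU2, Real.rpow_add hn0, Real.rpow_natCast, Real.rpow_neg hn0.le, div_le_iff₀ (by positivity)]
  have h1 : (n.factorial : ℝ) ≤ (n : ℝ) ^ n := by exact_mod_cast Nat.factorial_le_pow n
  have h2 : (n : ℝ) ^ (2 * η) ≤ (n : ℝ) ^ (2 * η * n) :=
    Real.rpow_le_rpow_of_exponent_le hn1 (by nlinarith)
  have h3 : 1 ≤ ((n : ℝ) ^ (2 * η))⁻¹ * (n : ℝ) ^ (2 * η * n) := by
    rw [inv_mul_eq_div, le_div_iff₀ (by positivity)]
    linarith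
  calc (n.factorial : ℝ) ≤ (n : ℝ) ^ n * 1 := by linarith
    _ ≤ (n : ℝ) ^ n * (((n : ℝ) ^ (2 * η))⁻¹ * (n : ℝ) ^ (2 * η * n)) := by gcongr
    _ = _ := by ring

/-- **Diagonalization**: if `F η n → 0` as `n → ∞` for each fixed `η > 0`, then `η` may be allowed
to tend slowly to zero. -/
lemma exists_tendsto_diagonal {F : ℝ → ℕ → ℝ} (hF0 : ∀ η n, 0 ≤ F η n) (hF1 : ∀ η n, F η n ≤ 1)
    (hF : ∀ η, 0 < η → Tendsto (F η) atTop (𝓝 0)) :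
    ∃ δ : ℕ → ℝ, Tendsto δ atTop (𝓝 0) ∧ Tendsto (fun n => F (δ n) n) atTop (𝓝 0) := by
  -- Take the finest level k ≤ n already attained at n. Level 0 always is, as F ≤ 1, and each fixed
  -- level is attained eventually.
  let p : ℕ → ℕ → Prop := fun n k => F (1 / ((k : ℝ) + 1)) n ≤ 1 / ((k : ℝ) + 1)
  let K : ℕ → ℕ := fun n => Nat.findGreatest (p n) n
  have hK : Tendsto K atTop atTop := by
    refine tendsto_atTop.2 fun k => ?_
    have hk : (0 : ℝ) < 1 / ((k : ℝ) + 1) := by positivity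
    filter_upwards [(hF _ hk).eventually_le_const hk, eventually_ge_atTop k] with n h1 h2
    exact Nat.le_findGreatest h2 h1
  have hδ : Tendsto (fun n => 1 / ((K n : ℝ) + 1)) atTop (𝓝 0) :=
    tendsto_one_div_add_atTop_nhds_zero_nat.comp hK
  refine ⟨_, hδ, squeeze_zero (fun n => hF0 _ _) (fun n => ?_) hδ⟩
  have : p n (K n) := Nat.findGreatest_spec (m := 0) (Nat.zero_le _) (by simpa [p] using hF1 _ _)
  exact this

/-! ### From counts of sign matrices to the given probability spaces. -/

section Transfer

variable {Ω : Type*} [MeasurableSpace Ω] {μ : Measure Ω} {n : ℕ}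
  {M : Ω → Matrix (Fin n) (Fin n) ℝ}

lemma measure_eq_signs (hM : IsBernoulliMatrix μ M) (xs : Fin n → Fin n → Bool) :
    μ.real {ω | M ω = Matrix.of fun i j => sgn (xs i j)} = 1 / ((2 : ℝ) ^ n) ^ n := by
  have h := hM.indep.measure_inter_preimage_eq_mul univ
    (sets := fun p => {sgn (xs p.1 p.2)}) (fun _ _ => measurableSet_singleton _)
  have hset : (⋂ p ∈ (univ : Finset (Fin n × Fin n)), (fun ω => M ω p.1 p.2) ⁻¹'
      {sgn (xs p.1 p.2)}) = {ω | M ω = Matrix.of fun i j => sgn (xs i j)} := by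
    ext ω
    simp [← Matrix.ext_iff]
  have hhalf : ∀ p : Fin n × Fin n, μ ((fun ω => M ω p.1 p.2) ⁻¹' {sgn (xs p.1 p.2)}) = 1 / 2 := by
    intro p
    cases hx : xs p.1 p.2
    · rw [show sgn false = -1 by simp [sgn]]
      exact hM.prob_neg_one p.1 p.2
    · rw [show sgn true = 1 by simp [sgn]]
      exact hM.prob_one p.1 p.2
  rw [hset, prod_congr rfl fun p _ => hhalf p] at h
  rw [Measure.real, h]
  simp [← pow_mul]

lemma measurableSet_eq_signs (hM : IsBernoulliMatrix μ M) (xs : Fin n → Fin n → Bool) :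
    MeasurableSet {ω | M ω = Matrix.of fun i j => sgn (xs i j)} := by
  have : {ω | M ω = Matrix.of fun i j => sgn (xs i j)} =
      ⋂ i, ⋂ j, (fun ω => M ω i j) ⁻¹' {sgn (xs i j)} := by
    ext ω
    simp [← Matrix.ext_iff]
  rw [this]
  exact MeasurableSet.iInter fun i => MeasurableSet.iInter fun j =>
    hM.measurable_entry i j (measurableSet_singleton _)

lemma sgn_injective : Function.Injective sgn := by
  intro a b h
  cases a <;> cases b <;> simp [sgn] at h ⊢ <;> norm_num at h

/-- The event contains the disjoint union, over good sign matrices, of the measurable sets where M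
equals that matrix. Only this inclusion is used, so P needs no measurability. -/
lemma one_sub_card_div_le_measure [IsProbabilityMeasure μ] (hM : IsBernoulliMatrix μ M)
    (P : Matrix (Fin n) (Fin n) ℝ → Prop) :
    1 - (#{xs : Fin n → Fin n → Bool | ¬ P (Matrix.of fun i j => sgn (xs i j))} : ℝ) /
      ((2 : ℝ) ^ n) ^ n ≤ μ.real {ω | P (M ω)} := by
  set G : Finset (Fin n → Fin n → Bool) := {xs | P (Matrix.of fun i j => sgn (xs i j))} with hG
  have hcard : (#{xs : Fin n → Fin n → Bool | ¬ P (Matrix.of fun i j => sgn (xs i j))} : ℝ) =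
      ((2 : ℝ) ^ n) ^ n - #G := by
    have h := card_filter_add_card_filter_not (s := (univ : Finset (Fin n → Fin n → Bool)))
      (fun xs => P (Matrix.of fun i j => sgn (xs i j)))
    simp only [card_univ, Fintype.card_fun, Fintype.card_bool, Fintype.card_fin] at h
    have h' : (#G : ℝ) + #{xs : Fin n → Fin n → Bool | ¬ P (Matrix.of fun i j => sgn (xs i j))} =
        ((2 : ℝ) ^ n) ^ n := by exact_mod_cast h
    linarith
  have hunion : μ.real (⋃ xs ∈ G, {ω | M ω = Matrix.of fun i j => sgn (xs i j)}) =
      #G * (1 / ((2 : ℝ) ^ n) ^ n) := by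
    rw [measureReal_biUnion_finset]
    · rw [sum_congr rfl fun xs _ => measure_eq_signs hM xs, sum_const, nsmul_eq_mul]
    · intro xs _ ys _ hne
      refine Set.disjoint_left.2 fun ω hx hy => hne ?_
      funext i j
      have := congrFun (congrFun (hx.symm.trans hy) i) j
      exact sgn_injective this
    · exact fun xs _ => measurableSet_eq_signs hM xs
  rw [hcard, sub_div, div_self (by positivity)]
  calc 1 - (1 - (#G : ℝ) / ((2 : ℝ) ^ n) ^ n) = #G * (1 / ((2 : ℝ) ^ n) ^ n) := by ring
    _ = _ := hunion.symm
    _ ≤ _ := by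
      refine measureReal_mono fun ω hω => ?_
      simp only [Set.mem_iUnion, Set.mem_ofPred_eq] at hω ⊢
      obtain ⟨xs, hxs, h⟩ := hω
      rw [h]
      exact (mem_filter.1 hxs).2

lemma one_sub_failProb_le_measure [IsProbabilityMeasure μ] (hM : IsBernoulliMatrix μ M)
    (P : ℝ → Prop) :
    1 - failProb rowStep (fun s => P (s ∅)) n (initState n) ≤
      μ.real {ω | P (M ω).permanent} := by
  refine le_trans (le_of_eq ?_) (one_sub_card_div_le_measure hM fun A => P A.permanent)
  rw [failProb_eq_card]
  simp only [runSteps_initState, Fintype.card_fun, Fintype.card_bool, Fintype.card_fin]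
  push_cast
  rfl

end Transfer

lemma exists_exponent {y δ : ℝ} {n : ℕ} (hn : 2 ≤ n)
    (h1 : (n : ℝ) ^ ((1 / 2 - δ) * n) ≤ y) (h2 : y ≤ (n : ℝ) ^ ((1 / 2 + δ) * n)) :
    ∃ e : ℝ, |e| ≤ δ ∧ y = (n : ℝ) ^ ((1 / 2 + e) * (n : ℝ)) := by
  have hn1 : (1 : ℝ) < n := by exact_mod_cast hn
  have hn0 : (0 : ℝ) < n := by linarith
  have hlog : 0 < Real.log n := Real.log_pos hn1
  have hy0 : 0 < y := lt_of_lt_of_le (by positivity) h1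
  have hyn : y = (n : ℝ) ^ Real.logb n y := (Real.rpow_logb hn0 hn1.ne' hy0).symm
  have h3 : (1 / 2 - δ) * n ≤ Real.logb n y := by
    rw [Real.le_logb_iff_rpow_le hn1 hy0]; exact h1
  have h4 : Real.logb n y ≤ (1 / 2 + δ) * n := by
    rw [Real.logb_le_iff_le_rpow hn1 hy0]; exact h2
  refine ⟨Real.logb n y / n - 1 / 2, abs_le.2 ⟨?_, ?_⟩, ?_⟩
  · have := (le_div_iff₀ hn0).2 h3
    linarith
  · have := (div_le_iff₀ hn0).2 h4
    linarith
  · rw [show (1 / 2 + (Real.logb n y / n - 1 / 2)) * (n : ℝ) = Real.logb n y by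
      field_simp; ring]
    exact hyn

end BernoulliPermanent

open BernoulliPermanent in
theorem theorem1 {Ω : ℕ → Type*} [∀ n, MeasurableSpace (Ω n)]
    (μ : ∀ n, Measure (Ω n)) [∀ n, IsProbabilityMeasure (μ n)]
    (M : ∀ n, Ω n → Matrix (Fin n) (Fin n) ℝ) (hM : ∀ n, IsBernoulliMatrix (μ n) (M n)) :
    (∃ δ : ℕ → ℝ, Tendsto δ atTop (𝓝 0) ∧
      Tendsto (fun n : ℕ => (μ n).real
        {ω | ∃ e : ℝ, |e| ≤ δ n ∧
          |(M n ω).permanent| = (n : ℝ) ^ ((1 / 2 + e) * (n : ℝ))}) atTop (𝓝 1)) ∧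
    Tendsto (fun n : ℕ => (μ n).real {ω | (M n ω).permanent ≠ 0}) atTop (𝓝 1) := by
  obtain ⟨δ, hδ, hlim⟩ := exists_tendsto_diagonal
    (F := fun η n => failProb rowStep (fun s => (n : ℝ) ^ ((1 / 2 - η) * n) ≤ |s ∅| ∧
      |s ∅| ≤ (n : ℝ) ^ ((1 / 2 + η) * n)) n (initState n))
    (fun _ _ => failProb_nonneg _ _ _ _) (fun _ _ => failProb_le_one _ _ _ _)
    (fun η hη => squeeze_zero (fun _ => failProb_nonneg _ _ _ _)
      (fun _ => failProb_and_le _ _ _ _ _)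
      (by simpa using (tendsto_failProb_lower hη).add (tendsto_failProb_upper hη)))
  have hlim' := hlim.const_sub 1
  rw [sub_zero] at hlim'
  -- One two-sided event yields both conclusions: its bounds give the exponent, and its positive
  -- lower bound gives nonvanishing.
  have key := fun n => one_sub_failProb_le_measure (hM n)
    (fun x => (n : ℝ) ^ ((1 / 2 - δ n) * n) ≤ |x| ∧ |x| ≤ (n : ℝ) ^ ((1 / 2 + δ n) * n))
  refine ⟨⟨δ, hδ, ?_⟩, ?_⟩
  · refine tendsto_of_tendsto_of_tendsto_of_le_of_le' hlim' tendsto_const_nhds ?_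
      (Eventually.of_forall fun n => measureReal_le_one)
    filter_upwards [eventually_ge_atTop 2] with n hn
    exact (key n).trans (measureReal_mono fun ω hω => exists_exponent hn hω.1 hω.2)
  · refine tendsto_of_tendsto_of_tendsto_of_le_of_le' hlim' tendsto_const_nhds ?_
      (Eventually.of_forall fun n => measureReal_le_one)
    filter_upwards [eventually_ge_atTop 2] with n hn
    refine (key n).trans (measureReal_mono fun ω hω => ?_)
    have hn0 : (0 : ℝ) < n := by exact_mod_cast (by omega : 0 < n)
    have : 0 < |(M n ω).permanent| := lt_of_lt_of_le (Real.rpow_pos_of_pos hn0 _) hω.1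
    exact abs_pos.1 this
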